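/- Let $\mathbb E,\mathbb H$ be finite-dimensional real vector spaces with duals $\mathbb E^*,\mathbb H^*$, let $K\subset\mathbb E$ be a regular cone (closed, convex, pointed, with nonempty interior), $K^*\subset\mathbb E^*$ its dual cone, $A:\mathbb E\to\mathbb H^*$ a surjective linear operator with adjoint $A^*:\mathbb H\to\mathbb E^*$, $b\in\mathbb H^*$, $c\in\mathbb E^*$. Let $F$ be a $\nu$-normal barrier for $K$: a $C^3$ convex function on $\operatorname{int}K$ which tends to $+\infty$ at the boundary of $K$ and satisfies, for all $x\in\operatorname{int}K$, $h\in\mathbb E$, $\tau>0$, $$|\nabla^3F(x)[h,h,h]|\le 2\langle\nabla^2F(x)h,h\rangle^{3/2},\qquad F(\tau x)=F(x)-\nu\ln\tau .$$ Let $F_*(s)=\max_{x\in\operatorname{int}K}\{-\langle s,x\rangle-F(x)\}$ be the dual barrier on $\operatorname{int}K^*$. Consider the primal problem $\min\{\langle c,x\rangle: Ax=b,\ x\in K\}$ and the dual problem $f^*=\max\{\langle b,y\rangle: y\in Q\}$, where $Q=\{y\in\mathbb H: s(y):=c-A^*y\in K^*\}$. Assume strict feasibility: there are $x_0\in\operatorname{int}K$,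 $s_0\in\operatorname{int}K^*$ and $y_0\in\mathbb H$ with $Ax_0=b$ and $s_0+A^*y_0=c$. Then for every $\mu>0$ there is a unique central point $(x_\mu,s_\mu,y_\mu)$ with $x_\mu\in\operatorname{int}K$ and $$Ax_\mu=b,\qquad c+\mu\nabla F(x_\mu)=A^*y_\mu,\qquad s_\mu=-\mu\nabla F(x_\mu).$$ Put $B=\nabla^2F(x_1)$ (the Hessian at $x_\mu$, $\mu=1$) and $G=AB^{-1}A^*$, with the norms $\|x\|_B=\langle Bx,x\rangle^{1/2}$ on $\mathbb E$ and $\|y\|_G=\langle Gy,y\rangle^{1/2}$ on $\mathbb H$. Let $y_*$ be an optimal solution of the dual problem and $s_*=c-A^*y_*$. Suppose that 1. (sharp dual optimum) $\gamma_d>0$ and $f^*-\langle b,y\rangle\ge\gamma_d\|y-y_*\|_G$ for all $y\in Q$; 2. $\sigma_d$ is a constant with $\|\nabla^2F_*(s_\mu)s_*\|_B\le\sigma_d$ for all $\mu\in(0,1]$. Then the trajectories $\mu\mapsto x_\mu$ and $\mu\mapsto y_\mu$ are differentiable at each $\mu\in(0,1]$, and for all $\mu\in(0,1]$ $$\|y_\mu-\mu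 y'_\mu-y_*\|_G\le\frac{4\sigma_d\nu^2}{\gamma_d^2}\,\mu^2,\qquad \|x'_\mu\|_B\le\sigma_p:=\sigma_d\Bigl(1+\frac{16\nu^4}{\gamma_d^2}\Bigr).$$ Consequently the limit $x_*=\lim_{\mu\downarrow0}x_\mu$ exists, it is the only limit point of the primal central path as $\mu\downarrow0$, and $\|x_\mu-x_*\|_B\le\sigma_p\,\mu$ for all $\mu\in(0,1]$. -/

import Mathlib

open Set Filter Topology

/-- A regular cone: closed and convex (both carried by `ProperCone`), pointed in the sense of
containing no straight line, and with nonempty interior. -/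
structure IsRegularCone {E : Type*} [NormedAddCommGroup E] [NormedSpace ℝ E]
    (K : ProperCone ℝ E) : Prop where
  salient : ∀ x ∈ K, -x ∈ K → x = 0
  nonempty_interior : (interior (K : Set E)).Nonempty

/-- The dual cone `K^* = {s : ⟨s, x⟩ ≥ 0 for all x ∈ K}`. -/
def dualCone {E : Type*} [NormedAddCommGroup E] [NormedSpace ℝ E]
    (K : ProperCone ℝ E) : Set (StrongDual ℝ E) :=
  {s | ∀ x ∈ K, 0 ≤ s x}

/-- The gradient `∇Φ(x) ∈ E^*`. -/
noncomputable def grad {E : Type*} [NormedAddCommGroup E] [NormedSpace ℝ E]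
    (Φ : E → ℝ) (x : E) : StrongDual ℝ E :=
  fderiv ℝ Φ x

/-- The Hessian `∇²Φ(x) : E → E^*`. -/
noncomputable def hess {E : Type*} [NormedAddCommGroup E] [NormedSpace ℝ E]
    (Φ : E → ℝ) (x : E) : E →L[ℝ] StrongDual ℝ E :=
  fderiv ℝ (grad Φ) x

/-- `F` is a `ν`-normal barrier for the cone `K`: a self-concordant, `ν`-logarithmically
homogeneous function on the interior of `K`. As usual, a self-concordant function is a convex
function of class `C³` which is closed, that is, which tends to `+∞` at the boundary of its
domain. The values of `F` outside the interior of `K` are irrelevant. -/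
structure IsNormalBarrier {E : Type*} [NormedAddCommGroup E] [NormedSpace ℝ E]
    (K : ProperCone ℝ E) (ν : ℝ) (F : E → ℝ) : Prop where
  contDiffOn : ContDiffOn ℝ 3 F (interior (K : Set E))
  convexOn : ConvexOn ℝ (interior (K : Set E)) F
  tendsto_boundary : ∀ x ∈ frontier (K : Set E),
    Tendsto F (𝓝[interior (K : Set E)] x) atTop
  self_concordant : ∀ x ∈ interior (K : Set E), ∀ h : E,
    |iteratedFDeriv ℝ 3 F x (fun _ => h)| ≤ 2 * (hess F x h h) ^ (3 / 2 : ℝ)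
  log_homogeneous : ∀ x ∈ interior (K : Set E), ∀ τ : ℝ, 0 < τ →
    F (τ • x) = F x - ν * Real.log τ

/-- The dual barrier `F_*(s) = max {-⟨s, x⟩ - F(x) : x ∈ int K}`. -/
noncomputable def dualBarrier {E : Type*} [NormedAddCommGroup E] [NormedSpace ℝ E]
    (K : ProperCone ℝ E) (F : E → ℝ) (s : StrongDual ℝ E) : ℝ :=
  sSup ((fun x => -s x - F x) '' interior (K : Set E))

/-- The canonical identification of `E` with `E^{**}`: `x` is sent to `s ↦ ⟨s, x⟩`. -/
noncomputable def bidualEquiv (E : Type*) [NormedAddCommGroup E] [NormedSpace ℝ E]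
    [FiniteDimensional ℝ E] : E ≃ₗ[ℝ] StrongDual ℝ (StrongDual ℝ E) :=
  LinearEquiv.ofInjectiveOfFinrankEq
    (NormedSpace.inclusionInDoubleDual ℝ E : E →ₗ[ℝ] StrongDual ℝ (StrongDual ℝ E))
    (NormedSpace.inclusionInDoubleDualLi ℝ).injective
    (by
      have h (V : Type _) [NormedAddCommGroup V] [NormedSpace ℝ V] [FiniteDimensional ℝ V] :
          Module.finrank ℝ (StrongDual ℝ V) = Module.finrank ℝ V :=
        (LinearMap.toContinuousLinearMap (𝕜 := ℝ) (E := V) (F' := ℝ)).symm.finrank_eq.trans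
          Subspace.dual_finrank_eq
      rw [h, h])

theorem bidualEquiv_apply {E : Type*} [NormedAddCommGroup E] [NormedSpace ℝ E]
    [FiniteDimensional ℝ E] (x : E) (s : StrongDual ℝ E) : bidualEquiv E x s = s x := rfl

/-- For an operator `B : X → X^*`, the norm `‖x‖_B = ⟨B x, x⟩^{1/2}`. -/
noncomputable def formNorm {X : Type*} [NormedAddCommGroup X] [NormedSpace ℝ X]
    (B : X →L[ℝ] StrongDual ℝ X) (x : X) : ℝ :=
  √(B x x)

/-- The data of the conic problem `min {⟨c, x⟩ : A x = b, x ∈ K}` and of its dual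
`max {⟨b, y⟩ : s + A^* y = c, s ∈ K^*}`, with a function `F` on the interior of `K` and a
parameter `ν`. -/
structure ConicProblem (E H : Type*) [NormedAddCommGroup E] [NormedSpace ℝ E]
    [NormedAddCommGroup H] [NormedSpace ℝ H] where
  K : ProperCone ℝ E
  F : E → ℝ
  ν : ℝ
  A : E →L[ℝ] StrongDual ℝ H
  b : StrongDual ℝ H
  c : StrongDual ℝ E

namespace ConicProblem

variable {E H : Type*} [NormedAddCommGroup E] [NormedSpace ℝ E]
  [NormedAddCommGroup H] [NormedSpace ℝ H]

/-- The adjoint `A^* : H → E^*`, `⟨A^* y, x⟩ = ⟨A x, y⟩`. -/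
noncomputable def adj (P : ConicProblem E H) : H →L[ℝ] StrongDual ℝ E :=
  P.A.flip

/-- The slack `s(y) = c - A^* y`. -/
noncomputable def slack (P : ConicProblem E H) (y : H) : StrongDual ℝ E :=
  P.c - P.adj y

/-- The dual feasible set `Q = {y : c - A^* y ∈ K^*}`. -/
def Q (P : ConicProblem E H) : Set H :=
  {y | P.slack y ∈ dualCone P.K}

/-- Strict feasibility of the primal and of the dual problem. -/
def StrictlyFeasible (P : ConicProblem E H) : Prop :=
  ∃ x₀ ∈ interior (P.K : Set E), ∃ s₀ ∈ interior (dualCone P.K), ∃ y₀ : H,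
    P.A x₀ = P.b ∧ s₀ + P.adj y₀ = P.c

/-- `(x, s, y)` is the point of the primal-dual central path with parameter `μ`. -/
structure IsCentralPoint (P : ConicProblem E H) (μ : ℝ) (x : E) (s : StrongDual ℝ E) (y : H) :
    Prop where
  mem_interior : x ∈ interior (P.K : Set E)
  primal : P.A x = P.b
  dual : P.c + μ • grad P.F x = P.adj y
  central : s = -(μ • grad P.F x)

/-- The optimal value `f^* = max {⟨b, y⟩ : y ∈ Q}` of the dual problem. -/
noncomputable def dualValue (P : ConicProblem E H) : ℝ :=
  sSup (P.b '' P.Q)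

/-- `y` is an optimal solution of the dual problem. -/
def IsDualOptimal (P : ConicProblem E H) (y : H) : Prop :=
  y ∈ P.Q ∧ ∀ y' ∈ P.Q, P.b y' ≤ P.b y

/-- For `B : E → E^*`, the operator `G = A B⁻¹ A^* : H → H^*`. -/
noncomputable def G (P : ConicProblem E H) (B : E →L[ℝ] StrongDual ℝ E) :
    H →L[ℝ] StrongDual ℝ H :=
  P.A ∘L B.inverse ∘L P.adj

/-- Sharpness of the dual optimal solution `ys`, with constant `γ`: for all `y ∈ Q`,
`f^* - ⟨b, y⟩ ≥ γ ‖y - ys‖_G`. -/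
def SharpDual (P : ConicProblem E H) (B : E →L[ℝ] StrongDual ℝ E) (ys : H) (γ : ℝ) : Prop :=
  ∀ y ∈ P.Q, γ * formNorm (P.G B) (y - ys) ≤ P.dualValue - P.b y

/-- The vector `∇²F_*(s) h ∈ E`, for `s, h ∈ E^*`. -/
noncomputable def dualHess [FiniteDimensional ℝ E] (P : ConicProblem E H)
    (s h : StrongDual ℝ E) : E :=
  (bidualEquiv E).symm (hess (dualBarrier P.K P.F) s h)

end ConicProblem

/-! ### Calculus of a normal barrier: gradient, Hessian, self-concordance along lines -/

section Barrier

variable {E : Type*} [NormedAddCommGroup E] [NormedSpace ℝ E] {K : ProperCone ℝ E} {ν : ℝ}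
  {F : E → ℝ}

/-! Write `H` for the Hessian of `F` at `x_μ` and `d = ∇²F_*(s_μ) s_*`. Duality and homogeneity make
`μ² H` the inverse of `∇²F_*(s_μ)`, so `μ² H d = s_*`. Differentiating the central path equations
gives `A x' = 0` and `∇F(x_μ) + μ H x' = A^* y'`. Hence `w = y_μ - μ y' - y_*` and `p = d - x'`
satisfy `A^* w = μ² H p`.

Pairing with `p` and using `A x' = 0` gives `μ² ⟨H p, p⟩ = ⟨A^* w, d⟩ ≤ σ ‖w‖_G`. In the other
direction, the dual Dikin ellipsoid lets one move from `y_μ` both ways along `w` inside `Q`, while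
the duality gap at `y_μ` is at most `νμ`. Sharpness then forces `‖w‖_G ≤ (νμ/γ) · μ ⟨H p, p⟩^{1/2}`.
Together these bound `‖w‖_G` by `σ ν² μ² / γ²`.

For the primal velocity, `⟨s_1, x_μ⟩ ≤ ν + νμ ≤ 2ν` yields `B ≤ (2ν)² H`. With `μ² ⟨H p, p⟩ ≤ ‖w‖_G
‖p‖_B` this bounds `‖p‖_B`, and `x' = d - p`. A path with bounded velocity on `(0, 1]` is Lipschitz,
hence converges at `0` at a linear rate.

The barrier facts used are nondegeneracy of the Hessian (`hess_pos`), the Dikin ellipsoid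
(`add_mem_interior_of_hess_lt_one`), and `⟨H v, v⟩^{1/2} ≤ -⟨∇F, v⟩` on `K` (`sqrt_hess_le`). The
last one gives both the dual Dikin ellipsoid and the Hessian comparison; `formNorm_tangent_le`
combines everything. -/

theorem ProperCone.add_mem_interior {x v : E} (hx : x ∈ interior (K : Set E)) (hv : v ∈ K) :
    x + v ∈ interior (K : Set E) := by
  refine mem_interior.2 ⟨(fun z => z - v) ⁻¹' interior (K : Set E), fun z hz => ?_,
    isOpen_interior.preimage (by fun_prop), by simpa using hx⟩
  have h : z - v ∈ K := interior_subset hz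
  simpa using add_mem h hv

theorem ProperCone.smul_mem_interior {x : E} (hx : x ∈ interior (K : Set E)) {τ : ℝ}
    (hτ : 0 < τ) : τ • x ∈ interior (K : Set E) := by
  refine mem_interior.2 ⟨(fun z => τ⁻¹ • z) ⁻¹' interior (K : Set E), fun z hz => ?_,
    isOpen_interior.preimage (by fun_prop), by simpa [smul_smul, hτ.ne'] using hx⟩
  have h : τ⁻¹ • z ∈ K := interior_subset hz
  simpa [smul_smul, hτ.ne'] using K.smul_mem h hτ.le

/-- A segment which leaves the interior of `K` meets the boundary for the first time. -/
theorem ProperCone.exists_exit {x h : E} {t₁ : ℝ} (hx : x ∈ interior (K : Set E)) (ht₁ : 0 ≤ t₁)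
    (hout : x + t₁ • h ∉ interior (K : Set E)) :
    ∃ T, 0 < T ∧ T ≤ t₁ ∧ (∀ t ∈ Ico 0 T, x + t • h ∈ interior (K : Set E)) ∧
      x + T • h ∈ frontier (K : Set E) := by
  have hcont : Continuous fun t : ℝ => x + t • h := by fun_prop
  set C : Set ℝ := Icc 0 t₁ ∩ (fun t : ℝ => x + t • h) ⁻¹' (interior (K : Set E))ᶜ with hC
  have hCc : IsCompact C :=
    isCompact_Icc.inter_right (isOpen_interior.isClosed_compl.preimage hcont)
  have hCn : C.Nonempty := ⟨t₁, ⟨ht₁, le_rfl⟩, hout⟩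
  obtain ⟨T, hT⟩ := hCc.exists_isLeast hCn
  have hT0 : T ≠ 0 := by
    rintro rfl
    exact hT.1.2 (by simpa using hx)
  have hTpos : 0 < T := lt_of_le_of_ne hT.1.1.1 hT0.symm
  have hin : ∀ t ∈ Ico 0 T, x + t • h ∈ interior (K : Set E) := by
    intro t ht
    by_contra hcon
    exact absurd (hT.2 ⟨⟨ht.1, ht.2.le.trans hT.1.1.2⟩, hcon⟩) (not_le.2 ht.2)
  refine ⟨T, hTpos, hT.1.1.2, hin, ?_, hT.1.2⟩
  have h1 : Tendsto (fun t : ℝ => x + t • h) (𝓝[<] T) (𝓝 (x + T • h)) :=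
    (hcont.tendsto T).mono_left nhdsWithin_le_nhds
  refine mem_closure_of_tendsto h1 ?_
  filter_upwards [Ioo_mem_nhdsLT hTpos] with t ht using interior_subset (hin t ⟨ht.1.le, ht.2⟩)

namespace IsNormalBarrier

theorem contDiffAt (hF : IsNormalBarrier K ν F) {x : E} (hx : x ∈ interior (K : Set E)) :
    ContDiffAt ℝ 3 F x :=
  hF.contDiffOn.contDiffAt (isOpen_interior.mem_nhds hx)

theorem contDiffAt_grad (hF : IsNormalBarrier K ν F) {x : E} (hx : x ∈ interior (K : Set E)) :
    ContDiffAt ℝ 2 (grad F) x :=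
  (hF.contDiffAt hx).fderiv_right (m := 2) (by norm_num)

theorem contDiffAt_hess (hF : IsNormalBarrier K ν F) {x : E} (hx : x ∈ interior (K : Set E)) :
    ContDiffAt ℝ 1 (hess F) x :=
  (hF.contDiffAt_grad hx).fderiv_right (m := 1) (by norm_num)

theorem hasFDerivAt (hF : IsNormalBarrier K ν F) {x : E} (hx : x ∈ interior (K : Set E)) :
    HasFDerivAt F (grad F x) x :=
  ((hF.contDiffAt hx).differentiableAt (by norm_num)).hasFDerivAt

theorem hasFDerivAt_grad (hF : IsNormalBarrier K ν F) {x : E}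
    (hx : x ∈ interior (K : Set E)) : HasFDerivAt (grad F) (hess F x) x :=
  ((hF.contDiffAt_grad hx).differentiableAt (by norm_num)).hasFDerivAt

theorem hasStrictFDerivAt_grad (hF : IsNormalBarrier K ν F) {x : E}
    (hx : x ∈ interior (K : Set E)) : HasStrictFDerivAt (grad F) (hess F x) x :=
  (hF.contDiffAt_grad hx).hasStrictFDerivAt (by norm_num)

theorem hess_symm (hF : IsNormalBarrier K ν F) {x : E} (hx : x ∈ interior (K : Set E))
    (u v : E) : hess F x u v = hess F x v u :=
  ((hF.contDiffAt hx).isSymmSndFDerivAt (by simp; norm_num)).eq u v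

theorem hasDerivAt_line (hF : IsNormalBarrier K ν F) {x h : E} {t : ℝ}
    (hx : x + t • h ∈ interior (K : Set E)) :
    HasDerivAt (fun t : ℝ => F (x + t • h)) (grad F (x + t • h) h) t := by
  have h1 : HasDerivAt (fun t : ℝ => x + t • h) h t := by
    simpa using ((hasDerivAt_id t).smul_const h).const_add x
  exact (hF.hasFDerivAt hx).comp_hasDerivAt t h1

theorem hasDerivAt_grad_line (hF : IsNormalBarrier K ν F) {x h : E} {t : ℝ}
    (hx : x + t • h ∈ interior (K : Set E)) (v : E) :
    HasDerivAt (fun t : ℝ => grad F (x + t • h) v) (hess F (x + t • h) h v) t := by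
  have h1 : HasDerivAt (fun t : ℝ => x + t • h) h t := by
    simpa using ((hasDerivAt_id t).smul_const h).const_add x
  have h2 := (hF.hasFDerivAt_grad hx).comp_hasDerivAt t h1
  exact h2.clm_apply (hasDerivAt_const t v) |>.congr_deriv (by simp)

/-- Self-concordance restricted to a line is the scalar inequality `|g'| ≤ 2 g^{3/2}` for `g(t) =
⟨∇²F(x + t h) h, h⟩`; all later uses of self-concordance go through it. -/
theorem exists_hasDerivAt_hess_line (hF : IsNormalBarrier K ν F) {x h : E} {t : ℝ}
    (hx : x + t • h ∈ interior (K : Set E)) :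
    ∃ d, HasDerivAt (fun t : ℝ => hess F (x + t • h) h h) d t ∧
      |d| ≤ 2 * (hess F (x + t • h) h h) ^ (3 / 2 : ℝ) := by
  have h1 : HasDerivAt (fun t : ℝ => x + t • h) h t := by
    simpa using ((hasDerivAt_id t).smul_const h).const_add x
  have h2 := ((hF.contDiffAt_hess hx).differentiableAt
    (by norm_num)).hasFDerivAt.comp_hasDerivAt t h1
  have h3 := (h2.clm_apply (hasDerivAt_const t h)).clm_apply (hasDerivAt_const t h)
  refine ⟨_, h3, ?_⟩
  have h4 := hF.self_concordant _ hx h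
  rw [iteratedFDeriv_succ_apply_right, iteratedFDeriv_succ_apply_right,
    iteratedFDeriv_one_apply] at h4
  simp only [Fin.init] at h4
  have h5 : |fderiv ℝ (hess F) (x + t • h) h h h| ≤ _ := h4
  simpa using h5

theorem grad_smul (hF : IsNormalBarrier K ν F) {x : E} (hx : x ∈ interior (K : Set E)) {τ : ℝ}
    (hτ : 0 < τ) : grad F (τ • x) = τ⁻¹ • grad F x := by
  have h1 : (fun y => F (τ • y)) =ᶠ[𝓝 x] fun y => F y - ν * Real.log τ := by
    filter_upwards [isOpen_interior.mem_nhds hx] with y hy using hF.log_homogeneous y hy τ hτ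
  have h2 := h1.fderiv_eq (𝕜 := ℝ)
  rw [fderiv_comp_smul, fderiv_sub_const] at h2
  rw [grad, grad, ← h2, smul_smul, inv_mul_cancel₀ hτ.ne', one_smul]

theorem hess_smul (hF : IsNormalBarrier K ν F) {x : E} (hx : x ∈ interior (K : Set E)) {τ : ℝ}
    (hτ : 0 < τ) : hess F (τ • x) = (τ⁻¹ ^ 2) • hess F x := by
  have h1 : (fun y => grad F (τ • y)) =ᶠ[𝓝 x] fun y => τ⁻¹ • grad F y := by
    filter_upwards [isOpen_interior.mem_nhds hx] with y hy using hF.grad_smul hy hτ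
  have h2 := h1.fderiv_eq (𝕜 := ℝ)
  rw [fderiv_comp_smul, fderiv_fun_const_smul (hF.hasFDerivAt_grad hx).differentiableAt] at h2
  rw [hess, hess, sq, mul_smul, ← h2, smul_smul, inv_mul_cancel₀ hτ.ne', one_smul]

theorem grad_self (hF : IsNormalBarrier K ν F) {x : E} (hx : x ∈ interior (K : Set E)) :
    grad F x x = -ν := by
  have h1 : HasDerivAt (fun τ : ℝ => F (τ • x)) (grad F x x) 1 := by
    have := HasFDerivAt.comp_hasDerivAt (f := fun τ : ℝ => τ • x) (l := F) (1 : ℝ)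
      (by rw [one_smul]; exact hF.hasFDerivAt hx) ((hasDerivAt_id (1 : ℝ)).smul_const x)
    simpa [Function.comp_def] using this
  have h2 : HasDerivAt (fun τ : ℝ => F x - ν * Real.log τ) (-ν) 1 := by
    simpa using ((Real.hasDerivAt_log one_ne_zero).const_mul ν).const_sub (F x)
  refine h1.unique (h2.congr_of_eventuallyEq ?_)
  filter_upwards [lt_mem_nhds (zero_lt_one (α := ℝ))] with τ hτ
    using hF.log_homogeneous x hx τ hτ

theorem hess_self (hF : IsNormalBarrier K ν F) {x : E} (hx : x ∈ interior (K : Set E)) :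
    hess F x x = -grad F x := by
  have h1 : HasDerivAt (fun τ : ℝ => grad F (τ • x)) (hess F x x) 1 := by
    have := HasFDerivAt.comp_hasDerivAt (f := fun τ : ℝ => τ • x) (l := grad F) (1 : ℝ)
      (by rw [one_smul]; exact hF.hasFDerivAt_grad hx) ((hasDerivAt_id (1 : ℝ)).smul_const x)
    simpa [Function.comp_def] using this
  have h2 : HasDerivAt (fun τ : ℝ => τ⁻¹ • grad F x) (-grad F x) 1 := by
    simpa using (hasDerivAt_inv (one_ne_zero (α := ℝ))).smul_const (grad F x)
  refine h1.unique (h2.congr_of_eventuallyEq ?_)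
  filter_upwards [lt_mem_nhds (zero_lt_one (α := ℝ))] with τ hτ
    using hF.grad_smul hx hτ

theorem line_mem_of_Icc {x y : E} (hx : x ∈ interior (K : Set E)) (hy : y ∈ interior (K : Set E))
    {t : ℝ} (ht : t ∈ Icc (0 : ℝ) 1) : x + t • (y - x) ∈ interior (K : Set E) :=
  K.convex.interior.add_smul_sub_mem hx hy ht

/-- The gradient inequality. -/
theorem add_grad_le (hF : IsNormalBarrier K ν F) {x y : E} (hx : x ∈ interior (K : Set E))
    (hy : y ∈ interior (K : Set E)) : F x + grad F x (y - x) ≤ F y := by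
  have hc : ConvexOn ℝ (Icc (0 : ℝ) 1) fun t : ℝ => F (x + t • (y - x)) := by
    have h1 := hF.convexOn.comp_affineMap (AffineMap.lineMap x y : ℝ →ᵃ[ℝ] E)
    refine (h1.subset (fun t ht => ?_) (convex_Icc 0 1)).congr fun t _ => ?_
    · simpa [AffineMap.lineMap_apply, add_comm] using line_mem_of_Icc hx hy ht
    · simp [AffineMap.lineMap_apply, add_comm]
  have h2 := hF.hasDerivAt_line (x := x) (h := y - x) (t := 0) (by simpa using hx)
  have h3 := hc.le_slope_of_hasDerivAt (by simp) (by simp) zero_lt_one h2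
  simp [slope] at h3
  rw [map_sub]
  linarith

/-- Adding the gradient inequalities in both directions makes the gradient monotone along the line;
its difference quotients are nonnegative and so is their limit. -/
theorem hess_nonneg (hF : IsNormalBarrier K ν F) {x : E} (hx : x ∈ interior (K : Set E))
    (h : E) : 0 ≤ hess F x h h := by
  have h2 := hF.hasDerivAt_grad_line (x := x) (h := h) (t := 0) (by simpa using hx) h
  have hev : ∀ᶠ t in 𝓝[>] (0 : ℝ), x + t • h ∈ interior (K : Set E) := by
    have hc : Continuous fun t : ℝ => x + t • h := by fun_prop
    refine (hc.tendsto 0).mono_left nhdsWithin_le_nhds (isOpen_interior.mem_nhds ?_)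
    simpa using hx
  have h3 := (hasDerivAt_iff_tendsto_slope.1 h2).mono_left
    (nhdsWithin_mono _ fun t (ht : t ∈ Ioi (0 : ℝ)) => (mem_Ioi.1 ht).ne')
  simp only [zero_smul, add_zero] at h3
  refine ge_of_tendsto h3 ?_
  filter_upwards [hev, self_mem_nhdsWithin] with t ht ht0
  have ht0 : 0 < t := ht0
  have h4 := hF.add_grad_le hx ht
  have h5 := hF.add_grad_le ht hx
  simp only [add_sub_cancel_left, map_smul, smul_eq_mul, sub_add_cancel_left, map_neg] at h4 h5
  simp only [slope, sub_zero, zero_smul, add_zero, vsub_eq_sub, smul_eq_mul]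
  refine mul_nonneg (by positivity) ?_
  by_contra hcon
  push Not at hcon
  nlinarith

/-- If `F` has bounded second derivative along a segment inside the domain, then the segment does
not reach the boundary. -/
theorem mem_of_hess_le (hF : IsNormalBarrier K ν F) {x h : E} {t₁ M : ℝ}
    (hx : x ∈ interior (K : Set E)) (ht₁ : 0 ≤ t₁)
    (hM : ∀ T ≤ t₁, (∀ t ∈ Ico 0 T, x + t • h ∈ interior (K : Set E)) →
      ∀ t ∈ Ico 0 T, hess F (x + t • h) h h ≤ M) :
    x + t₁ • h ∈ interior (K : Set E) := by
  by_contra hout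
  obtain ⟨T, hT0, hT1, hin, hfr⟩ := ProperCone.exists_exit hx ht₁ hout
  have hM := hM T hT1 hin
  have hM0 : 0 ≤ M := (hF.hess_nonneg hx h).trans (by simpa using hM 0 ⟨le_rfl, hT0⟩)
  -- Integrating the bound on the second derivative twice bounds `F` on `[0, T)`, against its
  -- blow-up at the exit point.
  have hgrad : ∀ t ∈ Ico 0 T, grad F (x + t • h) h ≤ grad F x h + M * T := by
    intro t ht
    have h1 := (convex_Ico 0 T).image_sub_le_mul_sub_of_deriv_le
      (f := fun t : ℝ => grad F (x + t • h) h)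
      (fun t ht => (hF.hasDerivAt_grad_line (hin t ht) h).continuousAt.continuousWithinAt)
      (fun t ht => (hF.hasDerivAt_grad_line (hin t (interior_subset ht))
        h).differentiableAt.differentiableWithinAt)
      (C := M) (fun t ht => by
        rw [(hF.hasDerivAt_grad_line (hin t (interior_subset ht)) h).deriv]
        exact hM t (interior_subset ht)) 0 ⟨le_rfl, hT0⟩ t ht ht.1
    simp only [zero_smul, add_zero, sub_zero] at h1
    nlinarith [mul_le_mul_of_nonneg_left ht.2.le hM0]
  have hval : ∀ t ∈ Ico 0 T, F (x + t • h) ≤ F x + |grad F x h + M * T| * T := by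
    intro t ht
    have h1 := (convex_Ico 0 T).image_sub_le_mul_sub_of_deriv_le
      (f := fun t : ℝ => F (x + t • h))
      (fun t ht => (hF.hasDerivAt_line (hin t ht)).continuousAt.continuousWithinAt)
      (fun t ht => (hF.hasDerivAt_line
        (hin t (interior_subset ht))).differentiableAt.differentiableWithinAt)
      (C := |grad F x h + M * T|) (fun t ht => by
        rw [(hF.hasDerivAt_line (hin t (interior_subset ht))).deriv]
        exact (hgrad t (interior_subset ht)).trans (le_abs_self _)) 0 ⟨le_rfl, hT0⟩ t ht ht.1
    simp only [zero_smul, add_zero, sub_zero] at h1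
    nlinarith [mul_le_mul_of_nonneg_left ht.2.le (abs_nonneg (grad F x h + M * T))]
  have hcont : Continuous fun t : ℝ => x + t • h := by fun_prop
  have htend : Tendsto (fun t : ℝ => x + t • h) (𝓝[<] T)
      (𝓝[interior (K : Set E)] (x + T • h)) := by
    refine tendsto_nhdsWithin_iff.2 ⟨(hcont.tendsto T).mono_left nhdsWithin_le_nhds, ?_⟩
    filter_upwards [Ioo_mem_nhdsLT hT0] with t ht using hin t ⟨ht.1.le, ht.2⟩
  have h2 := ((hF.tendsto_boundary _ hfr).comp htend).eventually_gt_atTop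
    (F x + |grad F x h + M * T| * T)
  obtain ⟨t, h3, h4⟩ := (h2.and (Ioo_mem_nhdsLT hT0)).exists
  exact absurd (hval t ⟨h4.1.le, h4.2⟩) (not_le.2 h3)

/-- On a compact segment `g ≤ M`, so `|g'| ≤ 2 g^{3/2} ≤ 2 √M g`: a linear inequality, and Grönwall
propagates the zero. -/
theorem hess_line_eq_zero (hF : IsNormalBarrier K ν F) {x h : E} {T : ℝ}
    (hin : ∀ t ∈ Icc 0 T, x + t • h ∈ interior (K : Set E)) (h0 : hess F x h h = 0) :
    ∀ t ∈ Icc 0 T, hess F (x + t • h) h h = 0 := by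
  intro t ht
  set g : ℝ → ℝ := fun t => hess F (x + t • h) h h with hg
  have hgc : ContinuousOn g (Icc 0 T) := fun t ht => by
    obtain ⟨d, hd, -⟩ := hF.exists_hasDerivAt_hess_line (hin t ht)
    exact hd.continuousAt.continuousWithinAt
  have hg0 : ∀ t ∈ Icc 0 T, 0 ≤ g t := fun t ht => hF.hess_nonneg (hin t ht) h
  obtain ⟨M, hM⟩ := isCompact_Icc.exists_bound_of_continuousOn hgc
  have hder : ∀ t ∈ Icc 0 T, HasDerivAt g (deriv g t) t ∧ |deriv g t| ≤ 2 * g t ^ (3 / 2 : ℝ) := by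
    intro t ht
    obtain ⟨d, hd, hd'⟩ := hF.exists_hasDerivAt_hess_line (hin t ht)
    rw [hd.deriv]
    exact ⟨hd, hd'⟩
  have h1 := norm_le_gronwallBound_of_norm_deriv_right_le (f := g) (f' := deriv g) (δ := 0)
    (K := 2 * √M) (ε := 0) (a := 0) (b := T) hgc
    (fun s hs => (hder s ⟨hs.1, hs.2.le⟩).1.hasDerivWithinAt) (by simp [hg, h0]) (fun s hs => by
      have hs' : s ∈ Icc 0 T := ⟨hs.1, hs.2.le⟩
      have h2 : g s ^ (3 / 2 : ℝ) = √(g s) * g s := by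
        rw [show (3 / 2 : ℝ) = 1 / 2 + 1 by norm_num,
          Real.rpow_add_one' (hg0 s hs') (by norm_num), Real.sqrt_eq_rpow]
      have h3 : √(g s) ≤ √M := Real.sqrt_le_sqrt ((le_abs_self _).trans (hM s hs'))
      rw [add_zero, Real.norm_of_nonneg (hg0 s hs'), Real.norm_eq_abs, mul_assoc]
      refine (hder s hs').2.trans ?_
      rw [h2]
      gcongr
      exact hg0 s hs') t ht
  rw [gronwallBound_ε0_δ0] at h1
  exact norm_le_zero_iff.1 h1

/-- In a degenerate direction the second derivative vanishes along the whole ray, which therefore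
never leaves the domain. Thus `h` is a recession direction, and so is `-h`, contradicting
pointedness. -/
theorem hess_pos (hF : IsNormalBarrier K ν F) (hK : IsRegularCone K) {x : E}
    (hx : x ∈ interior (K : Set E)) {h : E} (hh : h ≠ 0) : 0 < hess F x h h := by
  refine lt_of_le_of_ne (hF.hess_nonneg hx h) fun h0 => hh ?_
  have key : ∀ h : E, hess F x h h = 0 → h ∈ K := by
    intro h h0
    have hall : ∀ t : ℝ, 0 ≤ t → x + t • h ∈ interior (K : Set E) := fun t ht =>
      hF.mem_of_hess_le (M := 0) hx ht fun T _ hin s hs =>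
        (hF.hess_line_eq_zero (T := s) (fun r hr => hin r ⟨hr.1, hr.2.trans_lt hs.2⟩) h0 s
          ⟨hs.1, le_rfl⟩).le
    have hlim : Tendsto (fun t : ℝ => t⁻¹ • x + h) atTop (𝓝 ((0 : ℝ) • x + h)) :=
      (tendsto_inv_atTop_zero.smul_const x).add_const h
    rw [zero_smul, zero_add] at hlim
    refine K.isClosed.mem_of_tendsto hlim ?_
    filter_upwards [eventually_gt_atTop 0] with t ht
    have := K.smul_mem (interior_subset (hall t ht.le) : x + t • h ∈ K) (inv_nonneg.2 ht.le)
    simpa [smul_smul, ht.ne'] using this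
  exact hK.salient h (key h h0.symm) (key (-h) (by simpa using h0.symm))

/-- Along a line, `⟨∇²F h, h⟩^{-1/2}` is `1`-Lipschitz. -/
theorem abs_inv_sqrt_hess_sub_le (hF : IsNormalBarrier K ν F) (hK : IsRegularCone K) {x h : E}
    (hh : h ≠ 0) {T : ℝ} (hT : 0 ≤ T)
    (hin : ∀ t ∈ Icc 0 T, x + t • h ∈ interior (K : Set E)) :
    |(√(hess F (x + T • h) h h))⁻¹ - (√(hess F x h h))⁻¹| ≤ T := by
  set g : ℝ → ℝ := fun t => hess F (x + t • h) h h with hg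
  have hder : ∀ t ∈ Icc 0 T, HasDerivAt (fun t => (√(g t))⁻¹)
      (-(deriv g t / (2 * √(g t))) / √(g t) ^ 2) t ∧
      |-(deriv g t / (2 * √(g t))) / √(g t) ^ 2| ≤ 1 := by
    intro t ht
    obtain ⟨d, hd, hd'⟩ := hF.exists_hasDerivAt_hess_line (hin t ht)
    have hp : 0 < g t := hF.hess_pos hK (hin t ht) hh
    have hd : HasDerivAt g d t := hd
    have hs : 0 < √(g t) := Real.sqrt_pos.2 hp
    rw [hd.deriv]
    refine ⟨(hd.sqrt hp.ne').inv hs.ne', ?_⟩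
    have h2 : g t ^ (3 / 2 : ℝ) = √(g t) * √(g t) ^ 2 := by
      rw [show (3 / 2 : ℝ) = 1 / 2 + 1 by norm_num,
        Real.rpow_add_one' hp.le (by norm_num), ← Real.sqrt_eq_rpow, Real.sq_sqrt hp.le]
    have hd' : |d| ≤ 2 * g t ^ (3 / 2 : ℝ) := hd'
    rw [abs_div, abs_neg, abs_div, abs_of_pos (by positivity : 0 < 2 * √(g t)),
      abs_of_pos (by positivity : 0 < √(g t) ^ 2), div_div, div_le_one (by positivity)]
    linarith
  have h1 := (convex_Icc 0 T).norm_image_sub_le_of_norm_hasDerivWithin_le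
    (f := fun t => (√(g t))⁻¹) (C := 1)
    (fun t ht => (hder t ht).1.hasDerivWithinAt) (fun t ht => (hder t ht).2)
    (left_mem_Icc.2 hT) (right_mem_Icc.2 hT)
  simpa [hg, abs_of_nonneg hT] using h1

/-- The Dikin ellipsoid is contained in the domain. -/
theorem add_mem_interior_of_hess_lt_one (hF : IsNormalBarrier K ν F) (hK : IsRegularCone K)
    {x h : E} (hx : x ∈ interior (K : Set E)) (hlt : hess F x h h < 1) :
    x + h ∈ interior (K : Set E) := by
  rcases eq_or_ne h 0 with rfl | hh
  · simpa using hx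
  have hp := hF.hess_pos hK hx hh
  set r := (√(hess F x h h))⁻¹ with hr
  have hr1 : 1 < r := by
    refine (one_lt_inv₀ (Real.sqrt_pos.2 hp)).2 ?_
    rw [Real.sqrt_lt' one_pos]
    simpa using hlt
  -- By the Lipschitz bound, `⟨∇²F h, h⟩^{-1/2}` stays at least `r - t ≥ r - 1 > 0` on the segment.
  have := hF.mem_of_hess_le (h := h) (t₁ := 1) (M := ((r - 1)⁻¹) ^ 2) hx zero_le_one
    fun T hT hin t ht => by
      have h1 := hF.abs_inv_sqrt_hess_sub_le hK hh ht.1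
        (fun s hs => hin s ⟨hs.1, hs.2.trans_lt ht.2⟩)
      have hq := hF.hess_pos hK (hin t ht) hh
      have h2 := (abs_le.1 h1).1
      have h3 : r - 1 ≤ (√(hess F (x + t • h) h h))⁻¹ := by linarith [ht.2]
      have h4 : √(hess F (x + t • h) h h) ≤ (r - 1)⁻¹ :=
        (le_inv_comm₀ (by linarith) (Real.sqrt_pos.2 hq)).1 h3
      rw [← Real.sq_sqrt hq.le]
      gcongr
  simpa using this

/-- For interior `z`, the gradient inequality at `τ z` bounds `τ ⟨∇F(x), z⟩ + ν ln τ` above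
uniformly in `τ`, which a positive slope would violate for large `τ`. Other points of `K` are limits
of interior ones. -/
theorem grad_nonpos (hF : IsNormalBarrier K ν F) {x v : E} (hx : x ∈ interior (K : Set E))
    (hv : v ∈ K) : grad F x v ≤ 0 := by
  have hint : ∀ z ∈ interior (K : Set E), grad F x z ≤ 0 := by
    intro z hz
    by_contra hcon
    push Not at hcon
    have h1 : ∀ τ : ℝ, 0 < τ → τ * grad F x z + ν * Real.log τ ≤ F z - F x - ν := by
      intro τ hτ
      have h2 := hF.add_grad_le hx (ProperCone.smul_mem_interior hz hτ)
      rw [hF.log_homogeneous z hz τ hτ, map_sub, hF.grad_self hx, map_smul, smul_eq_mul] at h2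
      linarith
    have h3 : (fun τ : ℝ => ν * Real.log τ) =o[atTop] fun τ : ℝ => τ :=
      Real.isLittleO_log_id_atTop.const_mul_left ν
    have h4 := (h3.bound (half_pos hcon)).and ((eventually_gt_atTop 0).and
      (eventually_gt_atTop ((F z - F x - ν) / (grad F x z / 2))))
    obtain ⟨τ, h5, h6, h7⟩ := h4.exists
    rw [Real.norm_eq_abs, Real.norm_of_nonneg h6.le] at h5
    rw [div_lt_iff₀ (half_pos hcon)] at h7
    have := h1 τ h6
    have := (abs_le.1 h5).1
    nlinarith
  have hlim : Tendsto (fun t : ℝ => grad F x (v + t • x)) (𝓝[>] 0) (𝓝 (grad F x v)) := by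
    have hc : Continuous fun t : ℝ => grad F x (v + t • x) := by fun_prop
    have := (hc.tendsto 0).mono_left (nhdsWithin_le_nhds (s := Ioi 0))
    simpa using this
  refine le_of_tendsto hlim ?_
  filter_upwards [self_mem_nhdsWithin] with t ht
  rw [add_comm]
  exact hint _ (ProperCone.add_mem_interior (ProperCone.smul_mem_interior hx ht) hv)

/-- The local norm of a recession direction is bounded by the slope of the barrier. -/
theorem sqrt_hess_le (hF : IsNormalBarrier K ν F) (hK : IsRegularCone K) {x v : E}
    (hx : x ∈ interior (K : Set E)) (hv : v ∈ K) : √(hess F x v v) ≤ -grad F x v := by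
  rcases eq_or_ne v 0 with rfl | hv0
  · simp
  have hin : ∀ t : ℝ, 0 ≤ t → x + t • v ∈ interior (K : Set E) := fun t ht =>
    ProperCone.add_mem_interior hx (K.smul_mem hv ht)
  set a := (√(hess F x v v))⁻¹ with ha
  have ha0 : 0 < a := inv_pos.2 (Real.sqrt_pos.2 (hF.hess_pos hK hx hv0))
  have hder : ∀ t : ℝ, 0 ≤ t → HasDerivAt (fun t : ℝ => grad F (x + t • v) v + (a + t)⁻¹)
      (hess F (x + t • v) v v + -1 / (a + t) ^ 2) t := fun t ht =>
    (hF.hasDerivAt_grad_line (hin t ht) v).add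
      (((hasDerivAt_id t).const_add a).inv (by simp only [id]; positivity))
  -- The Lipschitz bound gives `⟨∇²F v, v⟩ ≥ (a + t)⁻²`, whose integral is compensated by `(a +
  -- t)⁻¹`. Since the slope is never positive, comparing `t = 0` with `t → ∞` leaves `⟨∇F(x), v⟩ +
  -- a⁻¹ ≤ 0`.
  have hmono : MonotoneOn (fun t : ℝ => grad F (x + t • v) v + (a + t)⁻¹) (Ici 0) := by
    refine monotoneOn_of_deriv_nonneg (convex_Ici 0)
      (fun t ht => (hder t ht).continuousAt.continuousWithinAt)
      (fun t ht => (hder t (interior_subset ht)).differentiableAt.differentiableWithinAt)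
      fun t ht => ?_
    have ht : 0 ≤ t := interior_subset ht
    rw [(hder t ht).deriv]
    have h1 := hF.abs_inv_sqrt_hess_sub_le hK hv0 ht fun s hs => hin s hs.1
    have hq := hF.hess_pos hK (hin t ht) hv0
    have h3 : (√(hess F (x + t • v) v v))⁻¹ ≤ a + t := by linarith [(abs_le.1 h1).2]
    have h4 : (a + t)⁻¹ ≤ √(hess F (x + t • v) v v) :=
      inv_le_of_inv_le₀ (Real.sqrt_pos.2 hq) h3
    have h5 : ((a + t)⁻¹) ^ 2 ≤ hess F (x + t • v) v v := by
      rw [← Real.sq_sqrt hq.le]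
      gcongr
    have h6 : -1 / (a + t) ^ 2 = -((a + t)⁻¹) ^ 2 := by rw [inv_pow, neg_div, one_div]
    rw [h6]
    linarith
  have hlim : Tendsto (fun t : ℝ => (a + t)⁻¹) atTop (𝓝 0) :=
    tendsto_inv_atTop_zero.comp (tendsto_atTop_add_const_left _ a tendsto_id)
  have hfin : grad F x v + a⁻¹ ≤ 0 := by
    refine ge_of_tendsto hlim ?_
    filter_upwards [eventually_ge_atTop 0] with t ht
    have h1 := hmono (mem_Ici.2 le_rfl) (mem_Ici.2 ht) ht
    simp only [zero_smul, add_zero] at h1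
    linarith [hF.grad_nonpos (hin t ht) hv]
  rw [ha, inv_inv] at hfin
  linarith

theorem dualBarrier_neg_grad (hF : IsNormalBarrier K ν F) {z : E}
    (hz : z ∈ interior (K : Set E)) :
    dualBarrier K F (-grad F z) = grad F z z - F z := by
  refine IsGreatest.csSup_eq ⟨⟨z, hz, by simp⟩, ?_⟩
  rintro _ ⟨w, hw, rfl⟩
  have := hF.add_grad_le hz hw
  rw [map_sub] at this
  simp only [neg_apply, neg_neg]
  linarith

end IsNormalBarrier

end Barrier

/-! ### The dual barrier and its Hessian -/

theorem finrank_strongDual (V : Type*) [NormedAddCommGroup V] [NormedSpace ℝ V]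
    [FiniteDimensional ℝ V] : Module.finrank ℝ (StrongDual ℝ V) = Module.finrank ℝ V :=
  (LinearMap.toContinuousLinearMap (𝕜 := ℝ) (E := V) (F' := ℝ)).symm.finrank_eq.trans
    Subspace.dual_finrank_eq

section Dual

variable {E : Type*} [NormedAddCommGroup E] [NormedSpace ℝ E] [FiniteDimensional ℝ E]
  {K : ProperCone ℝ E} {ν : ℝ} {F : E → ℝ}

theorem exists_dualEquiv_of_injective (B : E →L[ℝ] StrongDual ℝ E)
    (hB : ∀ h, B h = 0 → h = 0) :
    ∃ e : E ≃L[ℝ] StrongDual ℝ E, (e : E →L[ℝ] StrongDual ℝ E) = B := by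
  have hinj : Function.Injective (B : E →ₗ[ℝ] StrongDual ℝ E) :=
    (injective_iff_map_eq_zero _).2 hB
  exact ⟨(LinearEquiv.ofInjectiveOfFinrankEq _ hinj
    (finrank_strongDual E).symm).toContinuousLinearEquiv, by ext; rfl⟩

namespace IsNormalBarrier

theorem exists_hess_equiv (hF : IsNormalBarrier K ν F) (hK : IsRegularCone K) {x : E}
    (hx : x ∈ interior (K : Set E)) :
    ∃ e : E ≃L[ℝ] StrongDual ℝ E, (e : E →L[ℝ] StrongDual ℝ E) = hess F x := by
  refine exists_dualEquiv_of_injective _ fun h h0 => ?_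
  by_contra hh
  simpa [h0] using hF.hess_pos hK hx hh

/-- Let `X` be the local inverse of `z ↦ -∇F(z)`. The maximum defining `F_*(s)` is attained at
`X(s)`, so the envelope principle gives `∇F_*(s) = -X(s)`, and differentiating `X` gives the inverse
Hessian. The two minus signs cancel. -/
theorem hess_dualBarrier (hF : IsNormalBarrier K ν F) {x : E}
    (hx : x ∈ interior (K : Set E)) (e : E ≃L[ℝ] StrongDual ℝ E)
    (he : (e : E →L[ℝ] StrongDual ℝ E) = hess F x) (u : StrongDual ℝ E) :
    hess (dualBarrier K F) (-grad F x) u = bidualEquiv E (e.symm u) := by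
  have hf : ContDiffAt ℝ 1 (fun z => -grad F z) x :=
    ((hF.contDiffAt_grad hx).of_le (by norm_num)).neg
  set e' : E ≃L[ℝ] StrongDual ℝ E := e.trans (ContinuousLinearEquiv.neg ℝ) with he'
  have hf' : HasFDerivAt (fun z => -grad F z) (e' : E →L[ℝ] StrongDual ℝ E) x := by
    refine (hF.hasFDerivAt_grad hx).neg.congr_fderiv ?_
    rw [← he]
    ext
    simp [he']
  have hn : (1 : WithTop ℕ∞) ≠ 0 := one_ne_zero
  have hstrict := hf.hasStrictFDerivAt' hf' hn
  set X := hf.localInverse hf' hn with hX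
  have hXx : X (-grad F x) = x := hf.localInverse_apply_image hf' hn
  have hXc : ContDiffAt ℝ 1 X (-grad F x) := hf.to_localInverse hf' hn
  have hright : ∀ᶠ s in 𝓝 (-grad F x), -grad F (X s) = s := hstrict.eventually_right_inverse
  have hint : ∀ᶠ s in 𝓝 (-grad F x), X s ∈ interior (K : Set E) :=
    hXc.continuousAt (isOpen_interior.mem_nhds (by rwa [hXx]))
  have hdiff : ∀ᶠ s in 𝓝 (-grad F x), DifferentiableAt ℝ X s :=
    (hXc.eventually (by simp)).mono fun s hs => hs.differentiableAt (by simp)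
  have hval : ∀ᶠ s in 𝓝 (-grad F x), dualBarrier K F s = -s (X s) - F (X s) := by
    filter_upwards [hright, hint] with s h1 h2
    have h3 := hF.dualBarrier_neg_grad h2
    have h4 : grad F (X s) = -s := by rw [← h1, h1]; rw [neg_eq_iff_eq_neg.1 h1]
    rw [h1, h4] at h3
    simpa using h3
  have hgrad : grad (dualBarrier K F) =ᶠ[𝓝 (-grad F x)]
      fun s => -NormedSpace.inclusionInDoubleDual ℝ E (X s) := by
    filter_upwards [hright, hint, hdiff, hval.eventually_nhds] with s h1 h2 h3 h4
    have h5 : HasFDerivAt (fun s : StrongDual ℝ E => -s (X s) - F (X s)) _ s :=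
      ((hasFDerivAt_id s).clm_apply h3.hasFDerivAt).neg.sub
        ((hF.hasFDerivAt h2).comp s h3.hasFDerivAt)
    rw [grad, (h5.congr_of_eventuallyEq h4).fderiv]
    have h6 : grad F (X s) = -s := neg_eq_iff_eq_neg.1 h1
    ext δ
    simp [h6]
  have hX' : HasFDerivAt X (e'.symm : StrongDual ℝ E →L[ℝ] E) (-grad F x) :=
    hstrict.to_localInverse.hasFDerivAt
  have h7 : HasFDerivAt (fun s => -NormedSpace.inclusionInDoubleDual ℝ E (X s)) _ (-grad F x) :=
    HasFDerivAt.fun_neg (HasFDerivAt.comp (g := NormedSpace.inclusionInDoubleDual ℝ E) _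
      (ContinuousLinearMap.hasFDerivAt _) hX')
  rw [hess, (h7.congr_of_eventuallyEq hgrad).fderiv]
  have h8 : e'.symm u = -e.symm u := by
    rw [ContinuousLinearEquiv.symm_apply_eq]
    simp [he']
  ext δ
  simp [h8, bidualEquiv_apply]

end IsNormalBarrier

end Dual

namespace ConicProblem

variable {E H : Type*} [NormedAddCommGroup E] [NormedSpace ℝ E] [FiniteDimensional ℝ E]
  [NormedAddCommGroup H] [NormedSpace ℝ H] {P : ConicProblem E H}

theorem hess_dualHess (hK : IsRegularCone P.K) (hF : IsNormalBarrier P.K P.ν P.F) {x : E}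
    (hx : x ∈ interior (P.K : Set E)) (u : StrongDual ℝ E) :
    hess P.F x (P.dualHess (-grad P.F x) u) = u := by
  obtain ⟨e, he⟩ := hF.exists_hess_equiv hK hx
  rw [dualHess, hF.hess_dualBarrier hx e he, LinearEquiv.symm_apply_apply, ← he]
  simp

/-- Homogeneity reduces to the case without `μ`: `-μ ∇F(x) = -∇F(x/μ)` and `∇²F(x/μ) = μ² ∇²F(x)`.
-/
theorem smul_hess_dualHess (hK : IsRegularCone P.K) (hF : IsNormalBarrier P.K P.ν P.F) {x : E}
    (hx : x ∈ interior (P.K : Set E)) {μ : ℝ} (hμ : 0 < μ) (u : StrongDual ℝ E) :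
    μ ^ 2 • hess P.F x (P.dualHess (-(μ • grad P.F x)) u) = u := by
  have h1 := hess_dualHess hK hF (ProperCone.smul_mem_interior hx (inv_pos.2 hμ)) u
  rw [hF.grad_smul hx (inv_pos.2 hμ), hF.hess_smul hx (inv_pos.2 hμ), inv_inv] at h1
  simpa using h1

end ConicProblem

/-! ### Existence and uniqueness of central points -/

section Coercive

variable {E : Type*} [NormedAddCommGroup E] [NormedSpace ℝ E] {K : ProperCone ℝ E} {ν : ℝ}
  {F : E → ℝ}

/-- Subtracting from `s` a small multiple of a functional norming `x` stays in the dual cone;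
evaluate at `x`. -/
theorem exists_mul_norm_le_of_mem_interior_dualCone {s : StrongDual ℝ E}
    (hs : s ∈ interior (dualCone K)) : ∃ δ > 0, ∀ x ∈ K, δ * ‖x‖ ≤ s x := by
  obtain ⟨r, hr, hball⟩ := Metric.mem_nhds_iff.1 (mem_interior_iff_mem_nhds.1 hs)
  refine ⟨r / 2, by positivity, fun x hx => ?_⟩
  obtain ⟨g, hg1, hg2⟩ := exists_dual_vector'' ℝ x
  have h1 : s - (r / 2) • g ∈ dualCone K := by
    refine hball ?_
    rw [Metric.mem_ball, dist_eq_norm, sub_sub_cancel_left, norm_neg, norm_smul,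
      Real.norm_of_nonneg (by positivity)]
    nlinarith
  have h2 := h1 x hx
  simp only [RCLike.ofReal_real_eq_id, id_eq] at hg2
  simp only [sub_apply, smul_apply, smul_eq_mul, hg2] at h2
  linarith

/-- A normal barrier decreases slower than any multiple of the norm. -/
theorem IsNormalBarrier.exists_neg_mul_norm_sub_le (hF : IsNormalBarrier K ν F) {x₀ : E}
    (hx₀ : x₀ ∈ interior (K : Set E)) {ε : ℝ} (hε : 0 < ε) :
    ∃ C, ∀ x ∈ interior (K : Set E), -(ε * ‖x‖) - C ≤ F x := by
  -- The gradient inequality from `x₀` is applied at `τ x`: scaling shrinks the linear term below `ε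
  -- ‖x‖`, and by homogeneity costs only the constant `ν ln τ`.
  set N := ‖grad F x₀‖ with hN
  set τ := ε / (N + 1) with hτ
  have hN0 : 0 ≤ N := norm_nonneg _
  have hτ0 : 0 < τ := by positivity
  have hτN : τ * N ≤ ε := by
    rw [hτ, div_mul_eq_mul_div, div_le_iff₀ (by positivity)]
    nlinarith
  refine ⟨-(F x₀ + ν + ν * Real.log τ), fun x hx => ?_⟩
  have h1 := hF.add_grad_le hx₀ (ProperCone.smul_mem_interior hx hτ0)
  rw [hF.log_homogeneous x hx τ hτ0, map_sub, hF.grad_self hx₀, map_smul, smul_eq_mul] at h1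
  have h2 : -(N * ‖x‖) ≤ grad F x₀ x :=
    (abs_le.1 ((grad F x₀).le_opNorm x)).1
  have h3 : τ * N * ‖x‖ ≤ ε * ‖x‖ := by gcongr
  nlinarith [mul_le_mul_of_nonneg_left h2 hτ0.le]

end Coercive

namespace ConicProblem

variable {E H : Type*} [NormedAddCommGroup E] [NormedSpace ℝ E]
  [NormedAddCommGroup H] [NormedSpace ℝ H] {P : ConicProblem E H}

theorem adj_apply (y : H) (x : E) : P.adj y x = P.A x y := rfl

theorem adj_injective (hA : Function.Surjective P.A) : Function.Injective P.adj := by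
  intro y y' h
  refine (SeparatingDual.eq_iff_forall_dual_eq (R := ℝ)).2 fun g => ?_
  obtain ⟨x, rfl⟩ := hA g
  exact congrArg (fun f : StrongDual ℝ E => f x) h

/-- A functional vanishing on `ker A` factors through `A` by a right inverse, and the factor is
evaluation at some `y` because `H` is reflexive. -/
theorem exists_adj_eq [FiniteDimensional ℝ H] (hA : Function.Surjective P.A)
    (f : StrongDual ℝ E) (hf : ∀ h, P.A h = 0 → f h = 0) : ∃ y, f = P.adj y := by
  obtain ⟨R, hR⟩ := P.A.exists_rightInverse_of_surjective (LinearMap.range_eq_top.2 hA)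
  have hR' : ∀ g, P.A (R g) = g := fun g => congrArg (fun L => L g) hR
  refine ⟨(bidualEquiv H).symm (f ∘L R), ?_⟩
  ext x
  have h1 : f (x - R (P.A x)) = 0 := hf _ (by rw [map_sub, hR', sub_self])
  rw [adj_apply, ← bidualEquiv_apply (E := H), LinearEquiv.apply_symm_apply]
  rw [map_sub, sub_eq_zero] at h1
  exact h1

/-- Minimise `s₀ + μ F` on the slice `A x = b`, where `s₀` differs from `c` by a constant.
Coercivity of `s₀` and boundary blow-up of `F` make sublevel sets compact; stationarity along `ker
A` produces the multiplier `y`. -/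
theorem exists_isCentralPoint [FiniteDimensional ℝ E] [FiniteDimensional ℝ H]
    (hF : IsNormalBarrier P.K P.ν P.F) (hA : Function.Surjective P.A)
    (hstrict : P.StrictlyFeasible) {μ : ℝ} (hμ : 0 < μ) :
    ∃ x s y, P.IsCentralPoint μ x s y := by
  obtain ⟨x₀, hx₀, s₀, hs₀, y₀, hb, hc⟩ := hstrict
  obtain ⟨δ, hδ, hs₀K⟩ := exists_mul_norm_le_of_mem_interior_dualCone hs₀
  obtain ⟨C, hC⟩ := hF.exists_neg_mul_norm_sub_le hx₀ (ε := δ / (2 * μ)) (by positivity)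
  set Φ : E → ℝ := fun x => s₀ x + μ * P.F x with hΦ
  have hΦd : ∀ x ∈ interior (P.K : Set E), HasFDerivAt Φ (s₀ + μ • grad P.F x) x := fun x hx =>
    s₀.hasFDerivAt.add ((hF.hasFDerivAt hx).const_smul μ)
  have hΦn : ∀ x ∈ interior (P.K : Set E), δ / 2 * ‖x‖ - μ * C ≤ Φ x := by
    intro x hx
    have h1 := hs₀K x (interior_subset hx)
    have h2 := mul_le_mul_of_nonneg_left (hC x hx) hμ.le
    have h3 : μ * (-(δ / (2 * μ) * ‖x‖) - C) = -(δ / 2 * ‖x‖) - μ * C := by field_simp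
    rw [h3] at h2
    simp only [hΦ]
    linarith
  set S : Set E := {x | x ∈ interior (P.K : Set E) ∧ P.A x = P.b ∧ Φ x ≤ Φ x₀} with hS
  have hSclosed : IsClosed S := by
    refine isClosed_of_closure_subset fun x hx => ?_
    have hfreq : ∃ᶠ z in 𝓝 x, z ∈ S := mem_closure_iff_frequently.1 hx
    have hxK : x ∈ (P.K : Set E) :=
      P.K.isClosed.mem_of_frequently_of_tendsto (hfreq.mono fun z hz => interior_subset hz.1)
        tendsto_id
    have hxb : P.A x = P.b :=
      (isClosed_eq P.A.continuous continuous_const).mem_of_frequently_of_tendsto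
        (hfreq.mono fun z hz => hz.2.1) tendsto_id
    by_cases hxU : x ∈ interior (P.K : Set E)
    · refine ⟨hxU, hxb, ?_⟩
      by_contra hcon
      push Not at hcon
      obtain ⟨z, hz, hz'⟩ :=
        (hfreq.and_eventually ((hΦd x hxU).continuousAt.eventually (lt_mem_nhds hcon))).exists
      exact absurd hz.2.2 (not_le.2 hz')
    · exfalso
      have hfr : x ∈ frontier (P.K : Set E) := ⟨subset_closure hxK, hxU⟩
      have h1 := (hF.tendsto_boundary x hfr).eventually_gt_atTop (Φ x₀ / μ)
      rw [eventually_nhdsWithin_iff] at h1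
      obtain ⟨z, hz, hz'⟩ := (hfreq.and_eventually h1).exists
      have h2 := hz' hz.1
      have h3 : 0 ≤ s₀ z :=
        (by positivity : 0 ≤ δ * ‖z‖).trans (hs₀K z (interior_subset hz.1))
      have h4 := hz.2.2
      simp only [hΦ] at h4 h2
      rw [div_lt_iff₀ hμ] at h2
      linarith
  have hSbdd : Bornology.IsBounded S := by
    refine isBounded_iff_forall_norm_le.2 ⟨(Φ x₀ + μ * C) / (δ / 2), fun x hx => ?_⟩
    rw [le_div_iff₀ (by positivity)]
    linarith [hΦn x hx.1, hx.2.2]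
  have : ProperSpace E := FiniteDimensional.proper_real E
  obtain ⟨z, hz, hmin⟩ := (Metric.isCompact_of_isClosed_isBounded hSclosed
    hSbdd).exists_isMinOn ⟨x₀, hx₀, hb, le_rfl⟩ (f := Φ)
    (fun x hx => (hΦd x hx.1).continuousAt.continuousWithinAt)
  have hcrit : ∀ h, P.A h = 0 → (P.c + μ • grad P.F z) h = 0 := by
    intro h hh
    have h1 : HasDerivAt (fun t : ℝ => z + t • h) h 0 := by
      simpa using ((hasDerivAt_id (0 : ℝ)).smul_const h).const_add z
    have h2 : HasDerivAt (fun t : ℝ => Φ (z + t • h)) ((s₀ + μ • grad P.F z) h) 0 := by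
      refine HasFDerivAt.comp_hasDerivAt (l := Φ) (0 : ℝ) ?_ h1
      simpa using hΦd z hz.1
    have h3 : IsLocalMin (fun t : ℝ => Φ (z + t • h)) 0 := by
      have h4 : ∀ᶠ t in 𝓝 (0 : ℝ), z + t • h ∈ interior (P.K : Set E) :=
        h1.continuousAt (isOpen_interior.mem_nhds (by simpa using hz.1))
      filter_upwards [h4] with t ht
      rw [zero_smul, add_zero]
      rcases le_total (Φ (z + t • h)) (Φ x₀) with h5 | h5
      · exact hmin ⟨ht, by rw [map_add, map_smul, hh, smul_zero, add_zero, hz.2.1], h5⟩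
      · exact hz.2.2.trans h5
    have h6 := h3.hasDerivAt_eq_zero h2
    -- The extra term `⟨A^* y₀, h⟩` vanishes because `A h = 0`.
    rw [← hc]
    simpa [adj_apply, hh] using h6
  obtain ⟨y, hy⟩ := exists_adj_eq hA _ hcrit
  exact ⟨z, _, y, hz.1, hz.2.1, hy, rfl⟩

/-- The displacement `x' - x` lies in `ker A`, so both gradients agree on it, whereas `∇F` is
strictly monotone along the segment. -/
theorem IsCentralPoint.unique (hK : IsRegularCone P.K) (hF : IsNormalBarrier P.K P.ν P.F)
    (hA : Function.Surjective P.A) {μ : ℝ} (hμ : 0 < μ) {x x' : E} {s s' : StrongDual ℝ E}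
    {y y' : H} (h : P.IsCentralPoint μ x s y) (h' : P.IsCentralPoint μ x' s' y') :
    x = x' ∧ s = s' ∧ y = y' := by
  have hx : x = x' := by
    by_contra hne
    have hd : x' - x ≠ 0 := sub_ne_zero.2 (Ne.symm hne)
    have hAd : P.A (x' - x) = 0 := by rw [map_sub, h.primal, h'.primal, sub_self]
    have h1 : (P.c + μ • grad P.F x') (x' - x) = (P.c + μ • grad P.F x) (x' - x) := by
      rw [h.dual, h'.dual, adj_apply, adj_apply, hAd]
      simp
    have h2 : grad P.F x' (x' - x) = grad P.F x (x' - x) := by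
      simpa [hμ.ne'] using h1
    have hin : ∀ t ∈ Icc (0 : ℝ) 1, x + t • (x' - x) ∈ interior (P.K : Set E) := fun t ht =>
      IsNormalBarrier.line_mem_of_Icc h.mem_interior h'.mem_interior ht
    have h3 : StrictMonoOn (fun t : ℝ => grad P.F (x + t • (x' - x)) (x' - x)) (Icc 0 1) :=
      strictMonoOn_of_deriv_pos (convex_Icc 0 1)
        (fun t ht => (hF.hasDerivAt_grad_line (hin t ht) _).continuousAt.continuousWithinAt)
        fun t ht => by
          rw [(hF.hasDerivAt_grad_line (hin t (interior_subset ht)) _).deriv]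
          exact hF.hess_pos hK (hin t (interior_subset ht)) hd
    have h4 := h3 (left_mem_Icc.2 zero_le_one) (right_mem_Icc.2 zero_le_one) zero_lt_one
    simp [h2] at h4
  subst hx
  refine ⟨rfl, by rw [h.central, h'.central], adj_injective hA ?_⟩
  rw [← h.dual, ← h'.dual]

end ConicProblem

/-! ### Differentiability of the central path -/

namespace ConicProblem

variable {E H : Type*} [NormedAddCommGroup E] [NormedSpace ℝ E] [FiniteDimensional ℝ E]
  [NormedAddCommGroup H] [NormedSpace ℝ H] [FiniteDimensional ℝ H] {P : ConicProblem E H}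
  {x : ℝ → E} {s : ℝ → StrongDual ℝ E} {y : ℝ → H}

/-- The central path is differentiable. -/
theorem differentiableAt_centralPath (hK : IsRegularCone P.K) (hF : IsNormalBarrier P.K P.ν P.F)
    (hA : Function.Surjective P.A)
    (hc : ∀ μ : ℝ, 0 < μ → P.IsCentralPoint μ (x μ) (s μ) (y μ)) {μ : ℝ} (hμ : 0 < μ) :
    DifferentiableAt ℝ x μ ∧ DifferentiableAt ℝ y μ := by
  have hμc := hc μ hμ
  -- Keeping `μ` as a coordinate turns the implicit function problem into an inverse function
  -- problem: the central path is the preimage of the line `(μ, b, -c)`.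
  set Ψ : ℝ × E × H → ℝ × StrongDual ℝ H × StrongDual ℝ E :=
    fun z => (z.1, P.A z.2.1, z.1 • grad P.F z.2.1 - P.adj z.2.2) with hΨ
  have h1 : HasStrictFDerivAt (fun z : ℝ × E × H => z.1) (ContinuousLinearMap.fst ℝ ℝ (E × H))
      (μ, x μ, y μ) := hasStrictFDerivAt_fst
  have h2 : HasStrictFDerivAt (fun z : ℝ × E × H => z.2.1)
      ((ContinuousLinearMap.fst ℝ E H) ∘L (ContinuousLinearMap.snd ℝ ℝ (E × H)))
      (μ, x μ, y μ) := ((ContinuousLinearMap.fst ℝ E H) ∘L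
        (ContinuousLinearMap.snd ℝ ℝ (E × H))).hasStrictFDerivAt
  have h3 : HasStrictFDerivAt (fun z : ℝ × E × H => z.2.2)
      ((ContinuousLinearMap.snd ℝ E H) ∘L (ContinuousLinearMap.snd ℝ ℝ (E × H)))
      (μ, x μ, y μ) := ((ContinuousLinearMap.snd ℝ E H) ∘L
        (ContinuousLinearMap.snd ℝ ℝ (E × H))).hasStrictFDerivAt
  have h4 : HasStrictFDerivAt (fun z : ℝ × E × H => grad P.F z.2.1) _ (μ, x μ, y μ) :=
    HasStrictFDerivAt.comp (μ, x μ, y μ) (hF.hasStrictFDerivAt_grad hμc.mem_interior) h2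
  set D : ℝ × E × H →L[ℝ] ℝ × StrongDual ℝ H × StrongDual ℝ E :=
    (ContinuousLinearMap.fst ℝ ℝ (E × H)).prod
      ((P.A ∘L (ContinuousLinearMap.fst ℝ E H) ∘L (ContinuousLinearMap.snd ℝ ℝ (E × H))).prod
        (μ • (hess P.F (x μ) ∘L (ContinuousLinearMap.fst ℝ E H) ∘L
            (ContinuousLinearMap.snd ℝ ℝ (E × H))) +
          (ContinuousLinearMap.fst ℝ ℝ (E × H)).smulRight (grad P.F (x μ)) -
          P.adj ∘L (ContinuousLinearMap.snd ℝ E H) ∘L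
            (ContinuousLinearMap.snd ℝ ℝ (E × H)))) with hDdef
  have hD : HasStrictFDerivAt Ψ D (μ, x μ, y μ) :=
    h1.prodMk ((P.A.hasStrictFDerivAt.comp (μ, x μ, y μ) h2).prodMk
      ((h1.smul h4).sub (P.adj.hasStrictFDerivAt.comp (μ, x μ, y μ) h3)))
  -- A kernel vector has `A h = 0` and `μ ∇²F h = A^* k`; pairing with `h` gives `⟨∇²F h, h⟩ = 0`,
  -- so `h = 0`, then `k = 0`.
  have hinj : Function.Injective (D : ℝ × E × H →ₗ[ℝ] ℝ × StrongDual ℝ H × StrongDual ℝ E) := by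
    refine (injective_iff_map_eq_zero _).2 ?_
    rintro ⟨δ, h, k⟩ h0
    simp [hDdef] at h0
    obtain ⟨rfl, h5, h6⟩ := h0
    have h7 : h = 0 := by
      by_contra hne
      have h8 := hF.hess_pos hK hμc.mem_interior hne
      have h9 := congrArg (fun f : StrongDual ℝ E => f h) h6
      simp [adj_apply, h5, hμ.ne'] at h9
      exact h8.ne' h9
    subst h7
    have h10 : P.adj k = 0 := by simpa using h6
    have h11 : k = 0 := adj_injective hA (by rw [h10, map_zero])
    simp [h11]
  have hdim : Module.finrank ℝ (ℝ × E × H) =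
      Module.finrank ℝ (ℝ × StrongDual ℝ H × StrongDual ℝ E) := by
    simp only [Module.finrank_prod, finrank_strongDual]
    ring
  set e := (LinearEquiv.ofInjectiveOfFinrankEq _ hinj hdim).toContinuousLinearEquiv with he
  have heD : (e : ℝ × E × H →L[ℝ] ℝ × StrongDual ℝ H × StrongDual ℝ E) = D :=
    ContinuousLinearMap.ext fun z => rfl
  rw [← heD] at hD
  have hZ := hD.to_localInverse
  have hZ0 := hD.localInverse_apply_image
  have hZr := hD.eventually_right_inverse
  set Z := hD.localInverse Ψ e _ with hZdef
  have hΨ0 : Ψ (μ, x μ, y μ) = (μ, P.b, -P.c) := by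
    have h5 := hμc.dual
    simp only [hΨ, hμc.primal, Prod.mk.injEq, true_and]
    rw [← h5]
    abel
  rw [hΨ0] at hZ hZ0 hZr
  have hpath : DifferentiableAt ℝ (fun m : ℝ => (m, P.b, -P.c)) μ := by fun_prop
  have hZd : DifferentiableAt ℝ (fun m : ℝ => Z (m, P.b, -P.c)) μ :=
    (hZ.hasFDerivAt.comp (f := fun m : ℝ => (m, P.b, -P.c)) μ hpath.hasFDerivAt).differentiableAt
  have hev : ∀ᶠ m in 𝓝 μ, Ψ (Z (m, P.b, -P.c)) = (m, P.b, -P.c) :=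
    hpath.continuousAt.eventually hZr
  have hint : ∀ᶠ m in 𝓝 μ, (Z (m, P.b, -P.c)).2.1 ∈ interior (P.K : Set E) := by
    refine hZd.continuousAt.snd.fst.eventually (isOpen_interior.mem_nhds ?_)
    simpa only [hZ0] using hμc.mem_interior
  have heq : ∀ᶠ m in 𝓝 μ, x m = (Z (m, P.b, -P.c)).2.1 ∧ y m = (Z (m, P.b, -P.c)).2.2 := by
    filter_upwards [hev, hint, lt_mem_nhds hμ] with m hm1 hm2 hm3
    simp only [hΨ, Prod.ext_iff] at hm1
    obtain ⟨h5, h6, h7⟩ := hm1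
    have hcp : P.IsCentralPoint m (Z (m, P.b, -P.c)).2.1
        (-(m • grad P.F (Z (m, P.b, -P.c)).2.1)) (Z (m, P.b, -P.c)).2.2 := by
      refine ⟨hm2, h6, ?_, rfl⟩
      rw [h5] at h7
      rw [← sub_eq_zero, add_sub_assoc, h7]
      simp
    have := (hc m hm3).unique hK hF hA hm3 hcp
    exact ⟨this.1, this.2.2⟩
  exact ⟨hZd.snd.fst.congr_of_eventuallyEq (heq.mono fun m hm => hm.1),
    hZd.snd.snd.congr_of_eventuallyEq (heq.mono fun m hm => hm.2)⟩

theorem deriv_centralPath (hK : IsRegularCone P.K) (hF : IsNormalBarrier P.K P.ν P.F)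
    (hA : Function.Surjective P.A)
    (hc : ∀ μ : ℝ, 0 < μ → P.IsCentralPoint μ (x μ) (s μ) (y μ)) {μ : ℝ} (hμ : 0 < μ) :
    P.A (deriv x μ) = 0 ∧
      grad P.F (x μ) + μ • hess P.F (x μ) (deriv x μ) = P.adj (deriv y μ) := by
  obtain ⟨hx, hy⟩ := differentiableAt_centralPath hK hF hA hc hμ
  constructor
  · have h1 := P.A.hasFDerivAt.comp_hasDerivAt μ hx.hasDerivAt
    refine (h1.congr_of_eventuallyEq (f₁ := fun _ => P.b) ?_).unique (hasDerivAt_const μ P.b)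
    filter_upwards [lt_mem_nhds hμ] with m hm using (hc m hm).primal.symm
  · have h1 := P.adj.hasFDerivAt.comp_hasDerivAt μ hy.hasDerivAt
    have h2 := (hF.hasFDerivAt_grad (hc μ hμ).mem_interior).comp_hasDerivAt μ hx.hasDerivAt
    have h3 := ((hasDerivAt_id μ).smul h2).const_add P.c
    have h4 := (h1.congr_of_eventuallyEq (f₁ := fun m => P.c + m • grad P.F (x m)) (by
      filter_upwards [lt_mem_nhds hμ] with m hm using (hc m hm).dual)).unique h3
    rw [h4]
    simp [add_comm]

end ConicProblem

/-! ### Norms of positive forms, and paths of bounded velocity -/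

section FormNorm

variable {X : Type*} [NormedAddCommGroup X] [NormedSpace ℝ X] {B : X →L[ℝ] StrongDual ℝ X}

/-- The Cauchy-Schwarz inequality for a symmetric positive semidefinite form. -/
theorem abs_apply_le_formNorm_mul (hsymm : ∀ u v, B u v = B v u) (hpos : ∀ u, 0 ≤ B u u)
    (u v : X) : |B u v| ≤ formNorm B u * formNorm B v := by
  have h1 := LinearMap.BilinForm.apply_mul_apply_le_of_forall_zero_le
    (LinearMap.mk₂ ℝ (fun u v => B u v) (by simp) (by simp) (by simp) (by simp)) hpos u v
  simp only [LinearMap.mk₂_apply] at h1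
  rw [hsymm v u, ← sq] at h1
  rw [formNorm, formNorm, ← Real.sqrt_mul (hpos u)]
  exact Real.abs_le_sqrt h1

theorem formNorm_nonneg (B : X →L[ℝ] StrongDual ℝ X) (u : X) : 0 ≤ formNorm B u :=
  Real.sqrt_nonneg _

theorem sq_formNorm (hpos : ∀ u, 0 ≤ B u u) (u : X) : formNorm B u ^ 2 = B u u :=
  Real.sq_sqrt (hpos u)

theorem formNorm_smul (B : X →L[ℝ] StrongDual ℝ X) (r : ℝ) (u : X) :
    formNorm B (r • u) = |r| * formNorm B u := by
  have h : B (r • u) (r • u) = r ^ 2 * B u u := by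
    simp only [map_smul, smul_apply, smul_eq_mul]
    ring
  rw [formNorm, h, Real.sqrt_mul (sq_nonneg r), Real.sqrt_sq_eq_abs, formNorm]

theorem formNorm_sub_le (hsymm : ∀ u v, B u v = B v u) (hpos : ∀ u, 0 ≤ B u u) (u v : X) :
    formNorm B (u - v) ≤ formNorm B u + formNorm B v := by
  refine abs_le_of_sq_le_sq' ?_ (add_nonneg (formNorm_nonneg B u) (formNorm_nonneg B v)) |>.2
  have h1 := (abs_le.1 (abs_apply_le_formNorm_mul hsymm hpos u v)).1
  have h2 : B (u - v) (u - v) = B u u - 2 * B u v + B v v := by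
    simp only [map_sub, sub_apply, hsymm v u]
    ring
  rw [sq_formNorm hpos, h2, add_sq, sq_formNorm hpos, sq_formNorm hpos]
  linarith

theorem continuous_formNorm (B : X →L[ℝ] StrongDual ℝ X) : Continuous (formNorm B) := by
  unfold formNorm
  fun_prop

/-- The norm of an invertible positive form dominates the ambient norm. -/
theorem exists_norm_le_mul_formNorm (hsymm : ∀ u v, B u v = B v u) (hpos : ∀ u, 0 ≤ B u u)
    (e : X ≃L[ℝ] StrongDual ℝ X) (he : (e : X →L[ℝ] StrongDual ℝ X) = B) :
    ∃ C, 0 ≤ C ∧ ∀ u, ‖u‖ ≤ C * formNorm B u := by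
  have h1 : ∀ u, formNorm B u ≤ √‖B‖ * ‖u‖ := fun u => by
    refine Real.sqrt_le_iff.2 ⟨by positivity, ?_⟩
    rw [mul_pow, Real.sq_sqrt (norm_nonneg B)]
    calc B u u ≤ ‖B u‖ * ‖u‖ := (le_abs_self _).trans ((B u).le_opNorm u)
      _ ≤ ‖B‖ * ‖u‖ * ‖u‖ := by gcongr; exact B.le_opNorm u
      _ = ‖B‖ * ‖u‖ ^ 2 := by ring
  have h2 : ∀ u, ‖B u‖ ≤ √‖B‖ * formNorm B u := fun u =>
    (B u).opNorm_le_bound (mul_nonneg (by positivity) (formNorm_nonneg B u)) fun v => by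
      calc ‖B u v‖ ≤ formNorm B u * formNorm B v := abs_apply_le_formNorm_mul hsymm hpos u v
        _ ≤ formNorm B u * (√‖B‖ * ‖v‖) := by
          gcongr
          · exact formNorm_nonneg B u
          · exact h1 v
        _ = √‖B‖ * formNorm B u * ‖v‖ := by ring
  refine ⟨‖(e.symm : StrongDual ℝ X →L[ℝ] X)‖ * √‖B‖, by positivity, fun u => ?_⟩
  calc ‖u‖ = ‖(e.symm : StrongDual ℝ X →L[ℝ] X) (B u)‖ := by rw [← he]; simp
    _ ≤ ‖(e.symm : StrongDual ℝ X →L[ℝ] X)‖ * ‖B u‖ := ContinuousLinearMap.le_opNorm _ _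
    _ ≤ ‖(e.symm : StrongDual ℝ X →L[ℝ] X)‖ * (√‖B‖ * formNorm B u) := by gcongr; exact h2 u
    _ = _ := by ring

/-- A path with derivative bounded in the norm of `B` is Lipschitz in this norm. -/
theorem formNorm_sub_le_of_formNorm_deriv_le (hsymm : ∀ u v, B u v = B v u)
    (hpos : ∀ u, 0 ≤ B u u) {x : ℝ → X} {S : Set ℝ} (hS : Convex ℝ S) {L : ℝ}
    (hx : ∀ t ∈ S, DifferentiableAt ℝ x t) (hL : ∀ t ∈ S, formNorm B (deriv x t) ≤ L) {a b : ℝ}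
    (ha : a ∈ S) (hb : b ∈ S) : formNorm B (x b - x a) ≤ L * |b - a| := by
  set d := x b - x a with hd
  -- The scalar mean value inequality is applied to the path tested against `B d`, and a factor
  -- `‖d‖_B` is then cancelled.
  have h1 := hS.norm_image_sub_le_of_norm_hasDerivWithin_le (f := fun t => B d (x t))
    (f' := fun t => B d (deriv x t)) (C := formNorm B d * L)
    (fun t ht => ((B d).hasFDerivAt.comp_hasDerivAt t (hx t ht).hasDerivAt).hasDerivWithinAt)
    (fun t ht => (abs_apply_le_formNorm_mul hsymm hpos _ _).trans
      (mul_le_mul_of_nonneg_left (hL t ht) (formNorm_nonneg B d))) ha hb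
  rw [← map_sub, ← hd, ← sq_formNorm hpos, Real.norm_eq_abs, Real.norm_eq_abs, abs_sq] at h1
  have hL0 : 0 ≤ L := (formNorm_nonneg B _).trans (hL a ha)
  rcases (formNorm_nonneg B d).eq_or_lt with h0 | h0
  · rw [← h0]
    positivity
  · refine le_of_mul_le_mul_left ?_ h0
    linarith

/-- A path on `(0, 1]` with derivative bounded in the norm of `B` has a limit at `0`, with a linear
rate of convergence. -/
theorem exists_tendsto_of_formNorm_deriv_le [CompleteSpace X] (hsymm : ∀ u v, B u v = B v u)
    (hpos : ∀ u, 0 ≤ B u u) (e : X ≃L[ℝ] StrongDual ℝ X)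
    (he : (e : X →L[ℝ] StrongDual ℝ X) = B) {x : ℝ → X} {L : ℝ}
    (hx : ∀ t ∈ Ioc (0 : ℝ) 1, DifferentiableAt ℝ x t)
    (hL : ∀ t ∈ Ioc (0 : ℝ) 1, formNorm B (deriv x t) ≤ L) :
    ∃ xs, Tendsto x (𝓝[>] 0) (𝓝 xs) ∧ (∀ x', MapClusterPt x' (𝓝[>] 0) x → x' = xs) ∧
      ∀ μ ∈ Ioc (0 : ℝ) 1, formNorm B (x μ - xs) ≤ L * μ := by
  have hL0 : 0 ≤ L := (formNorm_nonneg B _).trans (hL 1 ⟨one_pos, le_rfl⟩)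
  have hlip : ∀ a ∈ Ioc (0 : ℝ) 1, ∀ b ∈ Ioc (0 : ℝ) 1,
      formNorm B (x b - x a) ≤ L * |b - a| := fun a ha b hb =>
    formNorm_sub_le_of_formNorm_deriv_le hsymm hpos (convex_Ioc 0 1) hx hL ha hb
  obtain ⟨C, hC0, hC⟩ := exists_norm_le_mul_formNorm hsymm hpos e he
  have hlip' : LipschitzOnWith (Real.toNNReal (C * L)) x (Ioc 0 1) :=
    LipschitzOnWith.of_dist_le_mul fun b hb a ha => by
      rw [dist_eq_norm, Real.dist_eq, Real.coe_toNNReal _ (by positivity), mul_assoc]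
      exact (hC _).trans (mul_le_mul_of_nonneg_left (hlip a ha b hb) hC0)
  have hle : 𝓝[>] (0 : ℝ) ≤ 𝓟 (Ioc 0 1) := by
    rw [le_principal_iff]
    exact Ioc_mem_nhdsGT one_pos
  have hcauchy : Cauchy (map x (𝓝[>] (0 : ℝ))) :=
    ((cauchy_nhds (a := (0 : ℝ))).mono nhdsWithin_le_nhds).map_of_le
      hlip'.uniformContinuousOn hle
  obtain ⟨xs, hxs⟩ := CompleteSpace.complete hcauchy
  have hxs : Tendsto x (𝓝[>] 0) (𝓝 xs) := hxs
  refine ⟨xs, hxs, fun x' hx' => ?_, fun μ hμ => ?_⟩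
  · have : (𝓝 x' ⊓ 𝓝 xs).NeBot := NeBot.mono hx' (inf_le_inf_left _ hxs)
    exact eq_of_nhds_neBot this
  · have h1 : Tendsto (fun t => formNorm B (x μ - x t)) (𝓝[>] 0) (𝓝 (formNorm B (x μ - xs))) :=
      ((continuous_formNorm B).tendsto _).comp (hxs.const_sub _)
    refine le_of_tendsto h1 ?_
    filter_upwards [Ioc_mem_nhdsGT hμ.1] with t ht
    refine (hlip t ⟨ht.1, ht.2.trans hμ.2⟩ μ hμ).trans ?_
    rw [abs_of_nonneg (sub_nonneg.2 ht.2)]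
    nlinarith [mul_nonneg hL0 ht.1.le]

end FormNorm

/-! ### The dual Dikin ellipsoid and comparison of Hessians -/

namespace IsNormalBarrier

variable {E : Type*} [NormedAddCommGroup E] [NormedSpace ℝ E] {K : ProperCone ℝ E} {ν : ℝ}
  {F : E → ℝ}

theorem nonneg (hF : IsNormalBarrier K ν F) {x : E} (hx : x ∈ interior (K : Set E)) : 0 ≤ ν := by
  have h := hF.hess_nonneg hx x
  rwa [hF.hess_self hx, neg_apply, hF.grad_self hx, neg_neg] at h

/-- The Dikin ellipsoid of the dual cone. -/
theorem neg_grad_sub_hess_mem_dualCone (hF : IsNormalBarrier K ν F) (hK : IsRegularCone K) {x z : E}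
    (hx : x ∈ interior (K : Set E)) (hz : formNorm (hess F x) z ≤ 1) :
    -grad F x - hess F x z ∈ dualCone K := by
  intro v hv
  have h1 := abs_apply_le_formNorm_mul (hF.hess_symm hx) (hF.hess_nonneg hx) z v
  have h2 := hF.sqrt_hess_le hK hx hv
  have h3 : formNorm (hess F x) z * formNorm (hess F x) v ≤ 1 * formNorm (hess F x) v := by
    gcongr
    exact formNorm_nonneg _ _
  have h4 := (le_abs_self _).trans h1
  simp only [sub_apply, neg_apply]
  rw [one_mul] at h3
  have h5 : formNorm (hess F x) v ≤ -grad F x v := h2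
  linarith

/-- Comparison of the Hessians of a normal barrier at two points `x`, `x'` in terms of
`⟨-∇F(x), x'⟩`. -/
theorem hess_le_mul_hess (hF : IsNormalBarrier K ν F) (hK : IsRegularCone K) {x x' : E}
    (hx : x ∈ interior (K : Set E)) (hx' : x' ∈ interior (K : Set E)) {R : ℝ}
    (hR : -grad F x x' ≤ R) (h : E) : hess F x h h ≤ R ^ 2 * hess F x' h h := by
  rcases eq_or_ne h 0 with rfl | hh
  · simp
  by_contra hcon
  push Not at hcon
  have hq := hF.hess_pos hK hx' hh
  have hN := hF.hess_pos hK hx hh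
  have h1 : R ^ 2 / hess F x h h < (hess F x' h h)⁻¹ := by
    rw [div_lt_iff₀ hN, inv_mul_eq_div, lt_div_iff₀ hq]
    exact hcon
  -- If the comparison fails, some `r` puts `x' ± √r h` in the Dikin ellipsoid at `x'` while `r
  -- ⟨∇²F(x) h, h⟩ > R²`. The local norms at `x` of these two points of `K` sum to at most `-2
  -- ⟨∇F(x), x'⟩ ≤ 2R`, and their difference is `2 √r h`: a contradiction.
  obtain ⟨r, hr1, hr2⟩ := exists_between h1
  have hr0 : 0 < r := lt_of_le_of_lt (by positivity) hr1
  have hsq : √r ^ 2 = r := Real.sq_sqrt hr0.le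
  have hquad : ∀ z : E, hess F z (√r • h) (√r • h) = r * hess F z h h := fun z => by
    simp only [map_smul, smul_apply, smul_eq_mul]
    rw [← mul_assoc, ← sq, hsq]
  have hlt : r * hess F x' h h < 1 := by
    rwa [lt_inv_comm₀ hr0 hq, ← one_div, lt_div_iff₀ hr0, mul_comm] at hr2
  have h2 : x' + √r • h ∈ interior (K : Set E) :=
    hF.add_mem_interior_of_hess_lt_one hK hx' (by rwa [hquad])
  have h3 : x' + -(√r • h) ∈ interior (K : Set E) :=
    hF.add_mem_interior_of_hess_lt_one hK hx' (by
      rw [map_neg, map_neg, neg_apply, neg_neg]; rwa [hquad])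
  have h4 := hF.sqrt_hess_le hK hx (interior_subset h2)
  have h5 := hF.sqrt_hess_le hK hx (interior_subset h3)
  have h6 := formNorm_sub_le (hF.hess_symm hx) (hF.hess_nonneg hx) (x' + √r • h)
    (x' + -(√r • h))
  have h7 : x' + √r • h - (x' + -(√r • h)) = (2 : ℝ) • √r • h := by module
  rw [h7, formNorm_smul, abs_two] at h6
  simp only [map_add, map_neg] at h4 h5
  have h8 : formNorm (hess F x) (√r • h) ≤ R := by
    simp only [formNorm] at h6 ⊢
    simp only [map_add, map_neg] at h6
    linarith
  have h9 : formNorm (hess F x) (√r • h) ^ 2 ≤ R ^ 2 := by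
    gcongr
    exact formNorm_nonneg _ _
  rw [sq_formNorm (hF.hess_nonneg hx), hquad] at h9
  rw [div_lt_iff₀ hN] at hr1
  linarith

end IsNormalBarrier

/-! ### Duality gap, sharpness and the tangent estimates -/

namespace ConicProblem

variable {E H : Type*} [NormedAddCommGroup E] [NormedSpace ℝ E]
  [NormedAddCommGroup H] [NormedSpace ℝ H] {P : ConicProblem E H}

theorem IsDualOptimal.dualValue_eq {ys : H} (h : P.IsDualOptimal ys) : P.dualValue = P.b ys :=
  IsGreatest.csSup_eq ⟨⟨ys, h.1, rfl⟩, by rintro _ ⟨y, hy, rfl⟩; exact h.2 y hy⟩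

theorem slack_add (y h : H) : P.slack (y + h) = P.slack y - P.adj h := by
  rw [slack, slack, map_add, sub_add_eq_sub_sub]

/-- `‖h‖_G` is the `B`-norm of `B⁻¹ A^* h`, so the triangle inequality for `G` is inherited from
`B`. -/
theorem formNorm_G {B : E →L[ℝ] StrongDual ℝ E} (e : E ≃L[ℝ] StrongDual ℝ E)
    (he : (e : E →L[ℝ] StrongDual ℝ E) = B) (h : H) :
    formNorm (P.G B) h = formNorm B (e.symm (P.adj h)) := by
  rw [formNorm, formNorm, G, ← he, ContinuousLinearMap.inverse_equiv]
  simp [adj_apply]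

namespace IsCentralPoint

variable {μ : ℝ} {x : E} {s : StrongDual ℝ E} {y : H}

theorem eq_slack (h : P.IsCentralPoint μ x s y) : s = P.slack y := by
  rw [h.central, slack, ← h.dual]
  abel

theorem apply_self (h : P.IsCentralPoint μ x s y) (hF : IsNormalBarrier P.K P.ν P.F) :
    s x = P.ν * μ := by
  rw [h.central, neg_apply, smul_apply, hF.grad_self h.mem_interior, smul_eq_mul]
  ring

theorem mem_dualCone (h : P.IsCentralPoint μ x s y) (hF : IsNormalBarrier P.K P.ν P.F)
    (hμ : 0 < μ) : s ∈ dualCone P.K := by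
  intro v hv
  rw [h.central, neg_apply, smul_apply, smul_eq_mul, ← mul_neg]
  exact mul_nonneg hμ.le (neg_nonneg.2 (hF.grad_nonpos h.mem_interior hv))

/-- The duality gap on the central path. -/
theorem sub_le_mul (h : P.IsCentralPoint μ x s y) (hF : IsNormalBarrier P.K P.ν P.F) {ys : H}
    (hys : ys ∈ P.Q) : P.b ys - P.b y ≤ P.ν * μ := by
  have h1 : 0 ≤ P.slack ys x := hys x (interior_subset h.mem_interior)
  have h2 := h.apply_self hF
  rw [h.eq_slack] at h2
  simp only [slack, sub_apply, adj_apply, h.primal] at h1 h2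
  linarith

/-- Primal differences lie in `ker A` and slack differences in the range of `A^*`, so `⟨s - s₁, x -
x₁⟩ = 0`; expand and drop `⟨s, x₁⟩ ≥ 0`. -/
theorem apply_le {x₁ : E} {s₁ : StrongDual ℝ E} {y₁ : H} {μ₁ : ℝ}
    (h : P.IsCentralPoint μ x s y) (h₁ : P.IsCentralPoint μ₁ x₁ s₁ y₁)
    (hF : IsNormalBarrier P.K P.ν P.F) (hμ : 0 < μ) : s₁ x ≤ P.ν * μ₁ + P.ν * μ := by
  have h2 : 0 ≤ s x₁ := h.mem_dualCone hF hμ x₁ (interior_subset h₁.mem_interior)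
  have h3 := h.apply_self hF
  have h4 := h₁.apply_self hF
  rw [h.eq_slack] at h2 h3
  rw [h₁.eq_slack] at h4 ⊢
  simp only [slack, sub_apply, adj_apply, h.primal, h₁.primal] at h2 h3 h4 ⊢
  linarith

/-- Under a sharp dual optimum, the norm of `G` is bounded on the central path by a multiple
of the local norm `⟨∇²F(x) z, z⟩^{1/2}`, where `A^* h = μ ∇²F(x) z`. -/
theorem formNorm_G_le [FiniteDimensional ℝ E] (h : P.IsCentralPoint μ x s y)
    (hK : IsRegularCone P.K) (hF : IsNormalBarrier P.K P.ν P.F) (hA : Function.Surjective P.A)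
    (hμ : 0 < μ) {B : E →L[ℝ] StrongDual ℝ E} (hsymm : ∀ u v, B u v = B v u)
    (hpos : ∀ u, 0 ≤ B u u) (e : E ≃L[ℝ] StrongDual ℝ E)
    (he : (e : E →L[ℝ] StrongDual ℝ E) = B) {ys : H} (hys : P.IsDualOptimal ys) {γ : ℝ}
    (hγ : 0 < γ) (hsharp : P.SharpDual B ys γ) {k : H} {z : E}
    (hz : P.adj k = μ • hess P.F x z) :
    formNorm (P.G B) k ≤ P.ν * μ / γ * formNorm (hess P.F x) z := by
  rcases eq_or_ne z 0 with rfl | hz0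
  · have hk : k = 0 := adj_injective hA (by rw [hz]; simp)
    simp [hk, formNorm]
  have hr : 0 < formNorm (hess P.F x) z := Real.sqrt_pos.2 (hF.hess_pos hK h.mem_interior hz0)
  set r := formNorm (hess P.F x) z with hrdef
  -- The step `1/r` brings `ε z` to the edge of the unit local ball, so the slack stays in the dual
  -- cone for both signs.
  have hQ : ∀ ε : ℝ, |ε| = r⁻¹ → y + ε • k ∈ P.Q := by
    intro ε hε v hv
    have h1 : formNorm (hess P.F x) (ε • z) ≤ 1 := by
      rw [formNorm_smul, hε, ← hrdef, inv_mul_cancel₀ hr.ne']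
    have h2 := hF.neg_grad_sub_hess_mem_dualCone hK h.mem_interior h1 v hv
    rw [slack_add, ← h.eq_slack, h.central, map_smul, hz]
    simp only [sub_apply, neg_apply, smul_apply, map_smul, smul_eq_mul] at h2 ⊢
    nlinarith
  have habs : |r⁻¹| = r⁻¹ := abs_of_pos (inv_pos.2 hr)
  have h1 := hsharp _ (hQ r⁻¹ habs)
  have h2 := hsharp _ (hQ (-r⁻¹) (by rw [abs_neg, habs]))
  have h3 := h.sub_le_mul hF hys.1
  have h4 := formNorm_sub_le hsymm hpos (e.symm (P.adj (y + r⁻¹ • k - ys)))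
    (e.symm (P.adj (y + (-r⁻¹) • k - ys)))
  rw [← map_sub, ← map_sub, ← formNorm_G e he, ← formNorm_G e he, ← formNorm_G e he,
    show y + r⁻¹ • k - ys - (y + (-r⁻¹) • k - ys) = (2 * r⁻¹) • k by module, formNorm_smul,
    abs_of_pos (by positivity : 0 < 2 * r⁻¹)] at h4
  rw [hys.dualValue_eq, map_add, map_smul, smul_eq_mul] at h1 h2
  -- Summing sharpness at the two symmetric points cancels the linear terms, leaving twice the gap
  -- at `y`; the points lie `2 r⁻¹ ‖k‖_G` apart.
  have h5 : γ * (r⁻¹ * formNorm (P.G B) k) ≤ P.ν * μ := by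
    nlinarith [mul_le_mul_of_nonneg_left h4 hγ.le]
  rw [div_mul_eq_mul_div, le_div_iff₀ hγ]
  calc formNorm (P.G B) k * γ = γ * (r⁻¹ * formNorm (P.G B) k) * r := by field_simp
    _ ≤ P.ν * μ * r := by gcongr

end IsCentralPoint

variable [FiniteDimensional ℝ E] [FiniteDimensional ℝ H]

/-- The quadratic error of the dual tangent, and the bound on the primal velocity. -/
theorem formNorm_tangent_le (hK : IsRegularCone P.K) (hF : IsNormalBarrier P.K P.ν P.F)
    (hA : Function.Surjective P.A) {x : ℝ → E} {s : ℝ → StrongDual ℝ E} {y : ℝ → H}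
    (hc : ∀ μ : ℝ, 0 < μ → P.IsCentralPoint μ (x μ) (s μ) (y μ)) {ys : H}
    (hys : P.IsDualOptimal ys) {γ : ℝ} (hγ : 0 < γ)
    (hsharp : P.SharpDual (hess P.F (x 1)) ys γ) {μ σ : ℝ} (hμ : μ ∈ Ioc (0 : ℝ) 1)
    (hσ : formNorm (hess P.F (x 1)) (P.dualHess (s μ) (P.slack ys)) ≤ σ) :
    formNorm (P.G (hess P.F (x 1))) (y μ - μ • deriv y μ - ys) ≤
        σ * P.ν ^ 2 / γ ^ 2 * μ ^ 2 ∧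
      formNorm (hess P.F (x 1)) (deriv x μ) ≤ σ * (1 + 4 * P.ν ^ 4 / γ ^ 2) := by
  have hμ0 := hμ.1
  have hcμ := hc μ hμ0
  have hc1 := hc 1 one_pos
  have hxμ := hcμ.mem_interior
  set B := hess P.F (x 1) with hB
  have hsymm : ∀ u v, B u v = B v u := hF.hess_symm hc1.mem_interior
  have hpos : ∀ u, 0 ≤ B u u := hF.hess_nonneg hc1.mem_interior
  have hposμ := hF.hess_nonneg hxμ
  obtain ⟨e, he⟩ := hF.exists_hess_equiv hK hc1.mem_interior
  have hν : 0 ≤ P.ν := hF.nonneg hxμ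
  have hσ0 : 0 ≤ σ := (formNorm_nonneg _ _).trans hσ
  obtain ⟨hAx, hgrad⟩ := deriv_centralPath hK hF hA hc hμ0
  set d := P.dualHess (s μ) (P.slack ys) with hd
  have hds : μ ^ 2 • hess P.F (x μ) d = P.slack ys := by
    rw [hd, hcμ.central]
    exact smul_hess_dualHess hK hF hxμ hμ0 _
  set w := y μ - μ • deriv y μ - ys with hw
  set p := d - deriv x μ with hp
  have hwp : P.adj w = μ ^ 2 • hess P.F (x μ) p := by
    have h1 : P.adj w = P.adj (y μ) - μ • P.adj (deriv y μ) - P.adj ys := by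
      rw [hw, map_sub, map_sub, map_smul]
    have h2 : hess P.F (x μ) p = hess P.F (x μ) d - hess P.F (x μ) (deriv x μ) := by
      rw [hp, map_sub]
    rw [h1, h2, smul_sub, hds, ← hgrad, slack, ← hcμ.dual]
    module
  set z := e.symm (P.adj w) with hz
  have hBz : B z = P.adj w := by rw [hB, ← he]; simp [hz]
  set N := formNorm (P.G B) w with hN
  have hNz : N = formNorm B z := formNorm_G e he w
  have hN0 : 0 ≤ N := formNorm_nonneg _ _
  have hμp : μ ^ 2 * hess P.F (x μ) p p = P.adj w p := by
    rw [hwp, smul_apply, smul_eq_mul]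
  -- Tangency `A x' = 0` replaces `p` by `d`, the vector whose norm is controlled by `σ`.
  have hpd : P.adj w p = P.adj w d := by
    rw [hp, map_sub, adj_apply w (deriv x μ), hAx]
    simp
  have h1 : μ ^ 2 * hess P.F (x μ) p p ≤ N * σ := by
    rw [hμp, hpd, ← hBz]
    refine ((le_abs_self _).trans (abs_apply_le_formNorm_mul hsymm hpos z d)).trans ?_
    rw [← hNz]
    gcongr
  have h2 : N ≤ P.ν * μ / γ * (μ * formNorm (hess P.F (x μ)) p) := by
    have h3 := hcμ.formNorm_G_le hK hF hA hμ0 hsymm hpos e he hys hγ hsharp (k := w)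
      (z := μ • p) (by rw [hwp, map_smul, smul_smul, sq])
    rwa [formNorm_smul, abs_of_pos hμ0] at h3
  have hw_le : N ≤ σ * P.ν ^ 2 / γ ^ 2 * μ ^ 2 := by
    have h3 : N ^ 2 ≤ σ * P.ν ^ 2 / γ ^ 2 * μ ^ 2 * N := by
      calc N ^ 2 ≤ (P.ν * μ / γ * (μ * formNorm (hess P.F (x μ)) p)) ^ 2 := by gcongr
        _ = P.ν ^ 2 * μ ^ 2 / γ ^ 2 * (μ ^ 2 * hess P.F (x μ) p p) := by
          rw [← sq_formNorm hposμ]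
          ring
        _ ≤ P.ν ^ 2 * μ ^ 2 / γ ^ 2 * (N * σ) := by gcongr
        _ = _ := by ring
    rcases hN0.eq_or_lt with h0 | h0
    · rw [← h0]
      positivity
    · refine le_of_mul_le_mul_right ?_ h0
      rwa [← sq]
  refine ⟨hw_le, ?_⟩
  -- Here `-⟨∇F(x_1), x_μ⟩ = ⟨s_1, x_μ⟩ ≤ ν + νμ`, and `μ ≤ 1`.
  have hR : -grad P.F (x 1) (x μ) ≤ 2 * P.ν := by
    have h3 := hcμ.apply_le hc1 hF hμ0
    rw [hc1.central, one_smul, neg_apply] at h3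
    nlinarith [hμ.2]
  have hcomp := hF.hess_le_mul_hess hK hc1.mem_interior hxμ hR p
  have hp_le : formNorm B p ≤ σ * (4 * P.ν ^ 4 / γ ^ 2) := by
    have h3 : μ ^ 2 * hess P.F (x μ) p p ≤ N * formNorm B p := by
      rw [hμp, ← hBz, hNz]
      exact (le_abs_self _).trans (abs_apply_le_formNorm_mul hsymm hpos z p)
    have h4 : μ ^ 2 * formNorm B p ^ 2 ≤ μ ^ 2 * (σ * (4 * P.ν ^ 4 / γ ^ 2)) * formNorm B p := by
      calc μ ^ 2 * formNorm B p ^ 2 ≤ μ ^ 2 * ((2 * P.ν) ^ 2 * hess P.F (x μ) p p) := by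
            rw [sq_formNorm hpos]
            gcongr
        _ = (2 * P.ν) ^ 2 * (μ ^ 2 * hess P.F (x μ) p p) := by ring
        _ ≤ (2 * P.ν) ^ 2 * (N * formNorm B p) := by gcongr
        _ ≤ (2 * P.ν) ^ 2 * (σ * P.ν ^ 2 / γ ^ 2 * μ ^ 2 * formNorm B p) := by
            gcongr
            exact formNorm_nonneg _ _
        _ = _ := by ring
    rcases (formNorm_nonneg B p).eq_or_lt with h0 | h0
    · rw [← h0]
      positivity
    · refine le_of_mul_le_mul_left ?_ (by positivity : 0 < μ ^ 2 * formNorm B p)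
      linarith
  have h5 := formNorm_sub_le hsymm hpos d p
  rw [hp, sub_sub_cancel, ← hp] at h5
  linarith

end ConicProblem

theorem mainTheorem7 {E H : Type*}
    [NormedAddCommGroup E] [NormedSpace ℝ E] [FiniteDimensional ℝ E]
    [NormedAddCommGroup H] [NormedSpace ℝ H] [FiniteDimensional ℝ H]
    (P : ConicProblem E H)
    (hK : IsRegularCone P.K)
    (hF : IsNormalBarrier P.K P.ν P.F)
    (hA : Function.Surjective P.A)
    (hstrict : P.StrictlyFeasible) :
    (∀ μ : ℝ, 0 < μ → ∃! z : E × StrongDual ℝ E × H, P.IsCentralPoint μ z.1 z.2.1 z.2.2) ∧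
    ∀ (x : ℝ → E) (s : ℝ → StrongDual ℝ E) (y : ℝ → H),
      (∀ μ : ℝ, 0 < μ → P.IsCentralPoint μ (x μ) (s μ) (y μ)) →
      ∀ B : E →L[ℝ] StrongDual ℝ E, B = hess P.F (x 1) →
      ∀ ys : H, P.IsDualOptimal ys →
      ∀ γ : ℝ, 0 < γ → P.SharpDual B ys γ →
      ∀ σ : ℝ, (∀ μ ∈ Ioc (0 : ℝ) 1, formNorm B (P.dualHess (s μ) (P.slack ys)) ≤ σ) →
        (∀ μ ∈ Ioc (0 : ℝ) 1, DifferentiableAt ℝ y μ ∧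
          formNorm (P.G B) (y μ - μ • deriv y μ - ys) ≤ 4 * σ * P.ν ^ 2 / γ ^ 2 * μ ^ 2) ∧
        (∀ μ ∈ Ioc (0 : ℝ) 1, DifferentiableAt ℝ x μ ∧
          formNorm B (deriv x μ) ≤ σ * (1 + 16 * P.ν ^ 4 / γ ^ 2)) ∧
        ∃ xs : E, Tendsto x (𝓝[>] 0) (𝓝 xs) ∧
          (∀ x' : E, MapClusterPt x' (𝓝[>] 0) x → x' = xs) ∧
          ∀ μ ∈ Ioc (0 : ℝ) 1,
            formNorm B (x μ - xs) ≤ σ * (1 + 16 * P.ν ^ 4 / γ ^ 2) * μ := by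
  constructor
  · intro μ hμ
    obtain ⟨x, s, y, h⟩ := ConicProblem.exists_isCentralPoint hF hA hstrict hμ
    refine ⟨(x, s, y), h, fun z hz => ?_⟩
    obtain ⟨h1, h2, h3⟩ := ConicProblem.IsCentralPoint.unique hK hF hA hμ hz h
    exact Prod.ext h1 (Prod.ext h2 h3)
  rintro x s y hc B rfl ys hys γ hγ hsharp σ hσ
  have hx1 := (hc 1 one_pos).mem_interior
  have hsymm := hF.hess_symm hx1
  have hpos := hF.hess_nonneg hx1
  obtain ⟨e, he⟩ := hF.exists_hess_equiv hK hx1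
  have hσ0 : 0 ≤ σ := (formNorm_nonneg _ _).trans (hσ 1 ⟨one_pos, le_rfl⟩)
  have hdiff : ∀ μ ∈ Ioc (0 : ℝ) 1, DifferentiableAt ℝ x μ ∧ DifferentiableAt ℝ y μ :=
    fun μ hμ => ConicProblem.differentiableAt_centralPath hK hF hA hc hμ.1
  -- The estimates obtained carry constants `1` and `4`; they are relaxed below to `4` and `16`.
  have hbound := fun μ hμ =>
    ConicProblem.formNorm_tangent_le hK hF hA hc hys hγ hsharp hμ (hσ μ hμ)
  have hdx : ∀ μ ∈ Ioc (0 : ℝ) 1,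
      formNorm (hess P.F (x 1)) (deriv x μ) ≤ σ * (1 + 16 * P.ν ^ 4 / γ ^ 2) := fun μ hμ => by
    refine (hbound μ hμ).2.trans ?_
    gcongr
    norm_num
  refine ⟨fun μ hμ => ⟨(hdiff μ hμ).2, (hbound μ hμ).1.trans ?_⟩,
    fun μ hμ => ⟨(hdiff μ hμ).1, hdx μ hμ⟩,
    exists_tendsto_of_formNorm_deriv_le hsymm hpos e he (fun μ hμ => (hdiff μ hμ).1) hdx⟩
  gcongr
  linarith
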